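/- All systems are finite-dimensional. ${\rm CPTP}(X,Y)$ denotes the completely positive trace-preserving maps from $X$ to $Y$, $\Delta(A,B)=\frac12\|A-B\|_1$ is the trace distance, and identity channels on reference systems are omitted. A quantum homomorphic encryption (QHE) scheme with plaintext systems $A,O$ and encrypted systems $\hat A,\hat O$ consists of a set $\mathscr F\subseteq{\rm CPTP}(A,O)$ of delegated channels, a random key $k\in\{0,1\}^L$, encryption channels ${\rm Enc}_k\in{\rm CPTP}(A,\hat A)$ and decryption channels ${\rm Dec}_k\in{\rm CPTP}(\hat O,O)$ for every $k\in\{0,1\}^L$, and an evaluation channel $\hat{\mathcal F}\in{\rm CPTP}(\hat A,\hat O)$ for every $\mathcal F\in\mathscr F$. The scheme is - $\epsilon$-correct if $\Delta\big({\rm Dec}_k\hat{\mathcal F}\,{\rm Enc}_k(|\psi\rangle\langle\psi|),\mathcal F(|\psi\rangle\langle\psi|)\big)\le\epsilon$ for every $\mathcal F\in\mathscr F$, every reference system $R$, every unit vector $|\psi\rangle\in A\otimes R$ and every $k\in\{0,1\}^L$; - $\epsilon_d$-data private if $\Delta\big(\mathbb E_k{\rm Enc}_k(\rho),\mathbb E_k{\rm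 Enc}_k(\rho')\big)\le\epsilon_d$ for all density matrices $\rho,\rho'$ on $A$; - $\epsilon_c$-circuit private if for every reference system $\hat R$ and every unit vector $|\psi\rangle\in\hat A\otimes\hat R$ there are a reference system $R$, a unit vector $|\psi'\rangle\in A\otimes R$ and a channel $\mathcal N\in{\rm CPTP}(O\otimes R,\hat O\otimes\hat R)$ such that $\Delta\big(\hat{\mathcal F}(|\psi\rangle\langle\psi|),\mathcal N(\mathcal F(|\psi'\rangle\langle\psi'|))\big)\le\epsilon_c$ for all $\mathcal F\in\mathscr F$. For bits $x_0,x_1$ let $\mathcal F_{(x_0,x_1)}$ be the strong oblivious transfer channel on two qubits, $$\mathcal F_{(x_0,x_1)}(\rho)=\sum_{i,i'\in\{0,1\}}\langle i,i'|\rho|i,i'\rangle\;\tfrac{\mathbb I_2}{2}\otimes|x_{i\oplus i'}\oplus i'\rangle\langle x_{i\oplus i'}\oplus i'| .$$ For bits $r_0,r_1,r_2,r_3$ let $\mathcal F_{(x_0,x_1)}^{(r_0,r_1,r_2,r_3)}$ be conjugation by the two-qubit Clifford unitary $$\big(X^{r_2}Z^{r_3}\otimes X^{x_0}\big)\,\big({\rm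 CNOT}_{1\to2}\,{\rm CNOT}_{2\to1}\big)^{x_0\oplus x_1}\,\big(Z^{r_0}\otimes Z^{r_1}\big),$$ where ${\rm CNOT}_{c\to t}$ has control $c$ and target $t$. Let $\epsilon,\epsilon_d,\epsilon_c$ be real numbers. Suppose that a QHE scheme is $\epsilon$-correct, $\epsilon_d$-data private and $\epsilon_c$-circuit private, and that one of the following holds: 1. $A$ and $O$ are two qubits and $\mathcal F_{(x_0,x_1)}\in\mathscr F$ for all $x_0,x_1\in\{0,1\}$; 2. $A$ and $O$ are two qubits and $\mathcal F_{(x_0,x_1)}^{(r_0,r_1,r_2,r_3)}\in\mathscr F$ for all $x_0,x_1,r_0,r_1,r_2,r_3\in\{0,1\}$; 3. $A$ and $O$ are $n$ qubits for some $n\ge2$, and $\mathscr F$ contains the channel $\rho\mapsto U\rho U^\dagger$ for every $n$-qubit Clifford unitary $U$ (a unitary that maps Pauli operators to Pauli operators, up to phase, under conjugation). Then $$\epsilon_c+\epsilon_d+4\sqrt{\epsilon}\ \ge\ \tfrac12 .$$ -/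

import Mathlib

open scoped ComplexOrder

namespace QHE

noncomputable section

/-! ### States, trace distance and channels on finite-dimensional systems

A finite-dimensional system is given by a finite index type of an orthonormal (computational)
basis; operators from a system to itself are complex square matrices over that type. -/

/-- Density matrices: positive semidefinite with trace one. -/
def IsDensity {X : Type*} [Fintype X] (ρ : Matrix X X ℂ) : Prop :=
  ρ.PosSemidef ∧ ρ.trace = 1

/-- Normalised state vectors. -/
def IsPureState {X : Type*} [Fintype X] (ψ : X → ℂ) : Prop :=
  ∑ x, ‖ψ x‖ ^ 2 = 1

/-- The rank-one operator `|ψ⟩⟨ψ|`. -/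
def proj {X : Type*} (ψ : X → ℂ) : Matrix X X ℂ :=
  Matrix.vecMulVec ψ (star ψ)

/-- The Schatten 1-norm `Tr √(A† A)`, i.e. the sum of the square roots of the eigenvalues
of `A† A`. -/
def traceNorm {X : Type*} [Fintype X] [DecidableEq X] (A : Matrix X X ℂ) : ℝ :=
  ∑ x, Real.sqrt ((Matrix.isHermitian_conjTranspose_mul_self A).eigenvalues x)

/-- The trace distance `Δ(A, B) = ½ ‖A - B‖₁`. -/
def traceDist {X : Type*} [Fintype X] [DecidableEq X] (A B : Matrix X X ℂ) : ℝ :=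
  (1 / 2) * traceNorm (A - B)

/-- `Φ ⊗ I_R` applied to an operator on the joint system `X R`. -/
def ampliate {X Y : Type*} (Φ : Matrix X X ℂ →ₗ[ℂ] Matrix Y Y ℂ) {R : Type*}
    (M : Matrix (X × R) (X × R) ℂ) : Matrix (Y × R) (Y × R) ℂ :=
  Matrix.of fun p q => Φ (Matrix.of fun x x' => M (x, p.2) (x', q.2)) p.1 q.1

/-- Completely positive trace preserving maps from `X` to `Y`. -/
@[ext]
structure Channel (X Y : Type*) [Fintype X] [Fintype Y] where
  toLin : Matrix X X ℂ →ₗ[ℂ] Matrix Y Y ℂ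
  completelyPositive : ∀ (n : ℕ) (M : Matrix (X × Fin n) (X × Fin n) ℂ),
    M.PosSemidef → (ampliate toLin M).PosSemidef
  tracePreserving : ∀ M : Matrix X X ℂ, (toLin M).trace = M.trace

/-- The action `𝓕(ρ)` of a channel. -/
def Channel.apply {X Y : Type*} [Fintype X] [Fintype Y] (F : Channel X Y)
    (ρ : Matrix X X ℂ) : Matrix Y Y ℂ :=
  F.toLin ρ

/-- The action `(𝓕 ⊗ I_R)(ρ)` of a channel next to a reference system `R`. -/
def Channel.applyRef {X Y : Type*} [Fintype X] [Fintype Y] (F : Channel X Y) {R : Type*}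
    (ρ : Matrix (X × R) (X × R) ℂ) : Matrix (Y × R) (Y × R) ℂ :=
  ampliate F.toLin ρ

/-- A linear map of the form `M ↦ ∑ K_j M K_j†` is completely positive. -/
theorem posSemidef_ampliate_of_kraus {X Y ι : Type*} [Fintype X] [Fintype Y] [Fintype ι]
    (Φ : Matrix X X ℂ →ₗ[ℂ] Matrix Y Y ℂ) (K : ι → Matrix Y X ℂ)
    (hΦ : ∀ M, Φ M = ∑ j, K j * M * (K j).conjTranspose)
    (n : ℕ) (M : Matrix (X × Fin n) (X × Fin n) ℂ) (hM : M.PosSemidef) :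
    (ampliate Φ M).PosSemidef := by
  classical
  have key : ampliate Φ M = ∑ j, (Matrix.kroneckerMap (fun a b => a * b) (K j)
      (1 : Matrix (Fin n) (Fin n) ℂ)) * M * (Matrix.kroneckerMap (fun a b => a * b) (K j)
      (1 : Matrix (Fin n) (Fin n) ℂ)).conjTranspose := by
    ext ⟨y, r⟩ ⟨y', r'⟩
    simp only [ampliate, hΦ, Matrix.of_apply, Matrix.sum_apply, Matrix.mul_apply,
      Matrix.conjTranspose_apply, Matrix.kroneckerMap_apply, Fintype.sum_prod_type,
      Matrix.one_apply, mul_ite, ite_mul, mul_one, mul_zero, zero_mul, Finset.sum_ite_eq,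
      Finset.mem_univ, if_true, apply_ite star, star_zero]
  rw [key]
  exact Matrix.posSemidef_sum _ fun j _ => hM.mul_mul_conjTranspose_same _

/-- The unitary channel `ρ ↦ U ρ U†`. -/
def unitaryChannel {X : Type*} [Fintype X] [DecidableEq X] (U : Matrix.unitaryGroup X ℂ) :
    Channel X X where
  toLin :=
    { toFun := fun ρ => (U : Matrix X X ℂ) * ρ * (U : Matrix X X ℂ).conjTranspose
      map_add' := fun a b => by rw [Matrix.mul_add, Matrix.add_mul]
      map_smul' := fun c a => by simp }
  completelyPositive := posSemidef_ampliate_of_kraus (ι := Unit) _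
    (fun _ => (U : Matrix X X ℂ)) (fun M => by simp)
  tracePreserving := fun M => by
    have h : (U : Matrix X X ℂ).conjTranspose * (U : Matrix X X ℂ) = 1 :=
      Matrix.mem_unitaryGroup_iff'.mp U.2
    change ((U : Matrix X X ℂ) * M * (U : Matrix X X ℂ).conjTranspose).trace = M.trace
    rw [Matrix.trace_mul_comm, ← Matrix.mul_assoc, h, Matrix.one_mul]

/-! ### Quantum homomorphic encryption -/

/-- A quantum homomorphic encryption scheme with plaintext input and output systems `A`, `O` and
encrypted input and output systems `Ahat`, `Ohat`: the set of delegated channels, the random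
`keyLength`-bit key with its distribution, and the encryption, evaluation and decryption maps. -/
structure Scheme (A O Ahat Ohat : Type*) [Fintype A] [Fintype O] [Fintype Ahat]
    [Fintype Ohat] where
  channels : Set (Channel A O)
  keyLength : ℕ
  keyGen : PMF (Fin keyLength → Bool)
  enc : (Fin keyLength → Bool) → Channel A Ahat
  eval : channels → Channel Ahat Ohat
  dec : (Fin keyLength → Bool) → Channel Ohat O

section Properties

variable {A O Ahat Ohat : Type*} [Fintype A] [Fintype O] [Fintype Ahat] [Fintype Ohat]

/-- `ε`-correctness: for every delegated channel, every purified input and every key,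
decrypting the evaluated encryption is `ε`-close to the channel output. -/
def Scheme.IsCorrect [DecidableEq O] (Q : Scheme A O Ahat Ohat) (ε : ℝ) : Prop :=
  ∀ (F : Q.channels) (m : ℕ) (ψ : A × Fin m → ℂ), IsPureState ψ →
    ∀ k : Fin Q.keyLength → Bool,
      traceDist
        ((Q.dec k).applyRef ((Q.eval F).applyRef ((Q.enc k).applyRef (proj ψ))))
        (F.1.applyRef (proj ψ)) ≤ ε

/-- The averaged encryption `𝔼_k Enc_k(ρ)`. -/
def Scheme.avgEnc (Q : Scheme A O Ahat Ohat) (ρ : Matrix A A ℂ) : Matrix Ahat Ahat ℂ :=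
  ∑ k, ((Q.keyGen k).toReal : ℂ) • (Q.enc k).apply ρ

/-- `ε`-data privacy: averaged encryptions of any two inputs are `ε`-close. -/
def Scheme.IsDataPrivate [DecidableEq Ahat] (Q : Scheme A O Ahat Ohat) (ε : ℝ) : Prop :=
  ∀ ρ ρ' : Matrix A A ℂ, IsDensity ρ → IsDensity ρ' →
    traceDist (Q.avgEnc ρ) (Q.avgEnc ρ') ≤ ε

/-- `ε`-circuit privacy: for every purified message `ψ` of a cheating Alice there are one purified
plaintext input `ψ'` and one post-processing channel `N` that simulate, up to `ε` and for all
delegated channels at once, what Alice receives, from what she would get in the ideal protocol. -/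
def Scheme.IsCircuitPrivate [DecidableEq Ohat] (Q : Scheme A O Ahat Ohat) (ε : ℝ) : Prop :=
  ∀ (m : ℕ) (ψ : Ahat × Fin m → ℂ), IsPureState ψ →
    ∃ (m' : ℕ) (ψ' : A × Fin m' → ℂ), IsPureState ψ' ∧
      ∃ N : Channel (O × Fin m') (Ohat × Fin m), ∀ F : Q.channels,
        traceDist ((Q.eval F).applyRef (proj ψ)) (N.apply (F.1.applyRef (proj ψ'))) ≤ ε

end Properties

/-! ### Qubits, Pauli and Clifford unitaries -/

/-- The computational basis of `n` qubits. -/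
abbrev Qubits (n : ℕ) : Type := Fin n → ZMod 2

/-- The sign `(-1)^t` of a bit `t`. -/
def sign (t : ZMod 2) : ℂ := (-1) ^ t.val

theorem sign_mul_self (t : ZMod 2) : sign t * sign t = 1 := by
  unfold sign
  rw [← mul_pow]
  norm_num

theorem star_sign (t : ZMod 2) : star (sign t) = sign t := by
  simp [sign]

/-- The Pauli unitary `X^a Z^b`, i.e. `|v⟩ ↦ (-1)^(b·v) |v + a⟩`. -/
def pauli {n : ℕ} (a b : Qubits n) : Matrix.unitaryGroup (Qubits n) ℂ :=
  ⟨Matrix.of fun u v => if u = v + a then sign (∑ j, b j * v j) else 0, by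
    rw [Matrix.mem_unitaryGroup_iff', Matrix.star_eq_conjTranspose]
    ext u v
    simp only [Matrix.mul_apply, Matrix.conjTranspose_apply, Matrix.of_apply, mul_ite, mul_zero,
      Finset.sum_ite_eq', Finset.mem_univ, if_true, add_left_inj,
      Matrix.one_apply]
    by_cases h : u = v
    · subst h
      simp [star_sign, sign_mul_self]
    · simp [h, Ne.symm h]⟩

/-- The `CNOT` gate with control `c` and target `t`, i.e. the target bit becomes
`v_t + v_c`. -/
def cnot {n : ℕ} (c t : Fin n) (h : c ≠ t) : Matrix.unitaryGroup (Qubits n) ℂ :=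
  ⟨Matrix.of fun u v => if u = Function.update v t (v t + v c) then 1 else 0, by
    have inj : Function.Injective
        (fun v : Qubits n => Function.update v t (v t + v c)) := by
      intro u v huv
      have hc : u c = v c := by simpa [h] using congrFun huv c
      funext j
      by_cases hj : j = t
      · subst hj
        simpa [hc] using congrFun huv j
      · simpa [hj] using congrFun huv j
    rw [Matrix.mem_unitaryGroup_iff', Matrix.star_eq_conjTranspose]
    ext u v
    simp only [Matrix.mul_apply, Matrix.conjTranspose_apply, Matrix.of_apply, mul_ite, mul_zero,
      mul_one, Finset.sum_ite_eq', Finset.mem_univ, if_true,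
      Matrix.one_apply, apply_ite star, star_one, star_zero]
    by_cases huv : u = v
    · simp [huv]
    · simp only [huv, if_false, ite_eq_right_iff]
      exact fun e => absurd (inj e).symm huv⟩

/-- `U` is in the Clifford group: conjugation by `U` maps Pauli operators to Pauli operators,
up to phase. -/
def IsClifford {n : ℕ} (U : Matrix.unitaryGroup (Qubits n) ℂ) : Prop :=
  ∀ a b : Qubits n, ∃ (a' b' : Qubits n) (c : ℂ),
    (U * pauli a b * U⁻¹ : Matrix.unitaryGroup (Qubits n) ℂ).1 = c • (pauli a' b').1

/-! ### Strong oblivious transfer channels and Cliffords -/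

/-- The bit of the pair `(x₀, x₁)` with index `i`. -/
def choose (x₀ x₁ i : ZMod 2) : ZMod 2 := if i = 0 then x₀ else x₁

/-- The strong oblivious transfer channel
`𝓕_(x₀,x₁)(ρ) = ∑_{i,i'} ⟨i,i'|ρ|i,i'⟩ (𝟙₂/2) ⊗ |x_{i⊕i'} ⊕ i'⟩⟨x_{i⊕i'} ⊕ i'|`; the sum over `o`
spells out the maximally mixed first output qubit, `(𝟙₂/2) = ½ ∑_o |o⟩⟨o|`. -/
def sotChannel (x₀ x₁ : ZMod 2) : Channel (Qubits 2) (Qubits 2) where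
  toLin :=
    { toFun := fun ρ => ∑ i : ZMod 2, ∑ i' : ZMod 2, ρ ![i, i'] ![i, i'] •
        ((1 / 2 : ℂ) • ∑ o : ZMod 2, Matrix.single ![o, choose x₀ x₁ (i + i') + i']
          ![o, choose x₀ x₁ (i + i') + i'] (1 : ℂ))
      map_add' := fun a b => by
        simp only [Matrix.add_apply, add_smul, Finset.sum_add_distrib]
      map_smul' := fun c a => by
        simp only [Matrix.smul_apply, smul_assoc, Finset.smul_sum, RingHom.id_apply] }
  completelyPositive := posSemidef_ampliate_of_kraus (ι := ZMod 2 × ZMod 2 × ZMod 2) _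
    (fun j => ((Real.sqrt (1 / 2) : ℝ) : ℂ) • Matrix.single
      ![j.2.2, choose x₀ x₁ (j.1 + j.2.1) + j.2.1] ![j.1, j.2.1] (1 : ℂ)) (fun M => by
      have hs : ((Real.sqrt (1 / 2) : ℝ) : ℂ) * ((Real.sqrt (1 / 2) : ℝ) : ℂ) = 1 / 2 := by
        rw [← Complex.ofReal_mul, Real.mul_self_sqrt (by norm_num)]
        norm_num
      simp only [Fintype.sum_prod_type, LinearMap.coe_mk, AddHom.coe_mk, Finset.smul_sum]
      refine Finset.sum_congr rfl fun i _ => Finset.sum_congr rfl fun i' _ =>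
        Finset.sum_congr rfl fun o _ => ?_
      rw [Matrix.conjTranspose_smul, Matrix.conjTranspose_single, Matrix.smul_mul,
        Matrix.smul_mul, Matrix.mul_smul, smul_smul, Matrix.single_mul_mul_single]
      simp only [star_one, mul_one, one_mul, RCLike.star_def, Complex.conj_ofReal]
      rw [smul_smul, hs, Matrix.smul_single, Matrix.smul_single, smul_eq_mul,
        smul_eq_mul, mul_one, mul_comm])
  tracePreserving := fun M => by
    have e : M.trace = ∑ i : ZMod 2, ∑ i' : ZMod 2, M ![i, i'] ![i, i'] := by
      rw [Matrix.trace, ← (finTwoArrowEquiv (ZMod 2)).symm.sum_comp, Fintype.sum_prod_type]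
      rfl
    simp only [LinearMap.coe_mk, AddHom.coe_mk, Matrix.trace_sum, Matrix.trace_smul,
      Matrix.trace_single_eq_same, e, Finset.sum_const, Finset.card_univ, ZMod.card]
    norm_num

/-- The two-qubit unitary of the strong oblivious transfer Cliffords, read as a circuit from right
to left: `Z^{r₀} ⊗ Z^{r₁}` (the dephasing of both inputs), then, if and only if `x₀ ≠ x₁`, a `CNOT`
from the second to the first qubit followed by a `CNOT` from the first to the second qubit, then
`X^{x₀}` on the second qubit and `X^{r₂} Z^{r₃}` (the depolarisation) on the first qubit. -/
def sotUnitary (x₀ x₁ r₀ r₁ r₂ r₃ : ZMod 2) : Matrix.unitaryGroup (Qubits 2) ℂ :=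
  pauli ![r₂, x₀] ![r₃, 0] *
    (if x₀ = x₁ then 1 else cnot 0 1 (by decide) * cnot 1 0 (by decide)) *
    pauli 0 ![r₀, r₁]

/-- The strong oblivious transfer Cliffords `𝓕_(x₀,x₁)^(r₀,r₁,r₂,r₃)`. -/
def sotClifford (x₀ x₁ r₀ r₁ r₂ r₃ : ZMod 2) : Channel (Qubits 2) (Qubits 2) :=
  unitaryChannel (sotUnitary x₀ x₁ r₀ r₁ r₂ r₃)

end

end QHE

/-!
A strong oblivious transfer channel lets the client learn one of two bits `x₀`, `x₁` of the server,
and never more than that: the output is, on average over the randomisation, a mixture of a part that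
depends on `x₀` only and a part that depends on `x₁` only, so both bits are guessed with average
probability at most `1/2` (`sum_re_trace_le_two_mul`). By circuit privacy, no attack on the
encrypted protocol has success probability above `1/2 + εc`. The proof exhibits an attack with
success probability at least `1 - εd - 4 √ε`.

The client encrypts the input that selects `x₀`, with the key in superposition, and keeps the
purification. Let the server hold the choice of channel in uniform superposition, together with the
environment of the evaluation, and let `τ₀`, `τ₁` be its reduced states when the client selects `x₀`
and `x₁`, respectively. Let `Z` be the operator `(-1) ^ x₁`.

* As `x₁` can be decrypted after selecting `x₁`, the state `τ₁` is almost invariant under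
  conjugation with `Z` (`re_trace_observable_conj_le`).
* By data privacy `τ₀` is close to `τ₁` (`re_trace_superposition_sub_le`), so `τ₀` is almost
  invariant, too.
* A party that purifies an almost invariant state can measure an observable that is correlated with
  `Z` (`exists_correlated_observable`). The correlation is `Tr (Z √τ₀ Z √τ₀)`, which the
  Powers–Størmer inequality bounds from below, linearly in the trace distance of `τ₀` and `Z τ₀ Z`;
  this is why `εd` enters the bound without a square root. Hence `x₁` is accessible to the client
  who selected `x₀`.
* That client first decrypts `x₀`, which by correctness hardly disturbs the state, and then measures
  `x₁` (`exists_joint_measurement`).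

For the Clifford channels, the average over the random bits `r₀`, `r₁`, `r₂` is computed from the
fact that all the gates are monomial matrices (`sum_sotClifford_applyRef_proj`). The bit `r₃` plays
no role, and the remaining qubits of an `n`-qubit register are mere spectators.
-/

namespace QHE

open Matrix

/-! ### Spectral calculus of Hermitian matrices -/

section Spectral

variable {X Y : Type*} [Fintype X] [DecidableEq X]

theorem exists_unitary_mul_diagonal {A : Matrix X X ℂ} (hA : A.IsHermitian) :
    ∃ (U : Matrix X X ℂ) (d : X → ℝ), Uᴴ * U = 1 ∧ U * Uᴴ = 1 ∧
      A = U * diagonal (fun i => (d i : ℂ)) * Uᴴ := by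
  refine ⟨hA.eigenvectorUnitary, hA.eigenvalues, ?_, ?_, ?_⟩
  · exact mem_unitaryGroup_iff'.mp hA.eigenvectorUnitary.2
  · exact mem_unitaryGroup_iff.mp hA.eigenvectorUnitary.2
  · conv_lhs => rw [hA.spectral_theorem, Unitary.conjStarAlgAut_apply]
    rfl

theorem posSemidef_conj_diagonal (U : Matrix X X ℂ) {f : X → ℝ} (hf : ∀ i, 0 ≤ f i) :
    (U * diagonal (fun i => (f i : ℂ)) * Uᴴ).PosSemidef := by
  refine PosSemidef.mul_mul_conjTranspose_same (PosSemidef.diagonal fun i => ?_) U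
  exact Complex.zero_le_real.2 (hf i)

theorem conj_diagonal_mul {U : Matrix X X ℂ} (hU : Uᴴ * U = 1) (f g : X → ℝ) :
    (U * diagonal (fun i => (f i : ℂ)) * Uᴴ) * (U * diagonal (fun i => (g i : ℂ)) * Uᴴ) =
      U * diagonal (fun i => ((f i * g i : ℝ) : ℂ)) * Uᴴ := by
  rw [show (U * diagonal (fun i => (f i : ℂ)) * Uᴴ) * (U * diagonal (fun i => (g i : ℂ)) * Uᴴ)
      = U * diagonal (fun i => (f i : ℂ)) * (Uᴴ * U) * (diagonal (fun i => (g i : ℂ)) * Uᴴ) by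
        simp only [Matrix.mul_assoc], hU, Matrix.mul_one, ← Matrix.mul_assoc,
      Matrix.mul_assoc U, diagonal_mul_diagonal]
  simp only [Complex.ofReal_mul]

/-- The square root `S` of a positive semidefinite matrix `τ`, with the generalised inverse `T`
of `S`. -/
theorem exists_sqrt_and_pinv {τ : Matrix X X ℂ} (hτ : τ.PosSemidef) :
    ∃ S T : Matrix X X ℂ, S.PosSemidef ∧ T.PosSemidef ∧ S * S = τ ∧ T * τ = S ∧
      T * (T * S) = T := by
  obtain ⟨U, d, hU, hU', rfl⟩ := exists_unitary_mul_diagonal hτ.1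
  have hd : ∀ i, 0 ≤ d i := by
    intro i
    have h := (hτ.conjTranspose_mul_mul_same U).diag_nonneg (i := i)
    have e : Uᴴ * (U * diagonal (fun i => (d i : ℂ)) * Uᴴ) * U =
        (Uᴴ * U) * diagonal (fun i => (d i : ℂ)) * (Uᴴ * U) := by
      simp only [Matrix.mul_assoc]
    rw [e, hU, Matrix.one_mul, Matrix.mul_one, diagonal_apply_eq] at h
    exact Complex.zero_le_real.1 h
  refine ⟨U * diagonal (fun i => ((√(d i) : ℝ) : ℂ)) * Uᴴ,
    U * diagonal (fun i => (((√(d i))⁻¹ : ℝ) : ℂ)) * Uᴴ,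
    posSemidef_conj_diagonal U fun i => by positivity,
    posSemidef_conj_diagonal U fun i => by positivity, ?_, ?_, ?_⟩
  · rw [conj_diagonal_mul hU]
    simp only [Real.mul_self_sqrt (hd _)]
  · rw [conj_diagonal_mul hU]
    have : ∀ i, (√(d i))⁻¹ * d i = √(d i) := fun i => by
      rw [inv_mul_eq_div, Real.div_sqrt]
    simp only [this]
  · rw [conj_diagonal_mul hU, conj_diagonal_mul hU]
    -- at a zero eigenvalue both factors vanish, since `0⁻¹ = 0`
    have : ∀ i, (√(d i))⁻¹ * ((√(d i))⁻¹ * √(d i)) = (√(d i))⁻¹ := fun i => by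
      by_cases h : √(d i) = 0
      · simp [h]
      · rw [inv_mul_cancel₀ h, mul_one]
    simp only [this]

theorem exists_eq_conjTranspose_mul_self {P : Matrix X X ℂ} (hP : P.PosSemidef) :
    ∃ g : Matrix X X ℂ, P = gᴴ * g := by
  obtain ⟨S, -, hS, -, h, -⟩ := exists_sqrt_and_pinv hP
  exact ⟨S, by rw [hS.1.eq, h]⟩

theorem re_trace_nonneg {Y : Type*} [Fintype Y] {A : Matrix Y Y ℂ} (hA : A.PosSemidef) :
    0 ≤ A.trace.re :=
  (Complex.nonneg_iff.mp hA.trace_nonneg).1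

theorem re_trace_mul_nonneg {A B : Matrix X X ℂ} (hA : A.PosSemidef) (hB : B.PosSemidef) :
    0 ≤ (A * B).trace.re := by
  obtain ⟨g, rfl⟩ := exists_eq_conjTranspose_mul_self hB
  rw [← Matrix.mul_assoc, trace_mul_comm, ← Matrix.mul_assoc]
  exact re_trace_nonneg (hA.mul_mul_conjTranspose_same g)

end Spectral

/-! ### Observables, effects and the trace norm -/

section Observable

/-- An observable with values in `[-1, 1]`, that is, a Hermitian matrix of operator norm at most
one. It is encoded by `-1 ≤ Q ≤ 1`, which makes it Hermitian. -/
def IsObservable {X : Type*} [Fintype X] [DecidableEq X] (Q : Matrix X X ℂ) : Prop :=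
  (1 - Q).PosSemidef ∧ (1 + Q).PosSemidef

variable {X : Type*} [Fintype X] [DecidableEq X]

theorem IsObservable.isHermitian {Q : Matrix X X ℂ} (hQ : IsObservable Q) : Q.IsHermitian := by
  have h := hQ.2.1.sub (isHermitian_one (n := X) (α := ℂ))
  rwa [add_sub_cancel_left] at h

theorem posSemidef_half_smul {Y : Type*} {A : Matrix Y Y ℂ} (hA : A.PosSemidef) :
    ((1 / 2 : ℂ) • A).PosSemidef :=
  hA.smul (by rw [Complex.nonneg_iff]; norm_num)

theorem isObservable_of_sq_eq_one {Z : Matrix X X ℂ} (hZ : Z.IsHermitian) (h : Z * Z = 1) :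
    IsObservable Z := by
  constructor
  · have e : (1 - Z) = (1 / 2 : ℂ) • ((1 - Z)ᴴ * (1 - Z)) := by
      rw [conjTranspose_sub, hZ.eq, conjTranspose_one, Matrix.sub_mul, Matrix.mul_sub,
        Matrix.mul_sub, h]
      simp only [Matrix.one_mul, Matrix.mul_one]
      module
    rw [e]
    exact posSemidef_half_smul (posSemidef_conjTranspose_mul_self _)
  · have e : (1 + Z) = (1 / 2 : ℂ) • ((1 + Z)ᴴ * (1 + Z)) := by
      rw [conjTranspose_add, hZ.eq, conjTranspose_one, Matrix.add_mul, Matrix.mul_add,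
        Matrix.mul_add, h]
      simp only [Matrix.one_mul, Matrix.mul_one]
      module
    rw [e]
    exact posSemidef_half_smul (posSemidef_conjTranspose_mul_self _)

theorem IsObservable.one_sub_mul_self {Q : Matrix X X ℂ} (hQ : IsObservable Q) :
    (1 - Q * Q).PosSemidef := by
  have e : 1 - Q * Q = (1 / 2 : ℂ) •
      ((1 - Q) * (1 + Q) * (1 - Q)ᴴ + (1 + Q) * (1 - Q) * (1 + Q)ᴴ) := by
    rw [conjTranspose_sub, conjTranspose_add, hQ.isHermitian.eq, conjTranspose_one]
    simp only [Matrix.sub_mul, Matrix.mul_sub, Matrix.add_mul, Matrix.mul_add, Matrix.one_mul,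
      Matrix.mul_one, Matrix.mul_assoc]
    module
  rw [e]
  exact posSemidef_half_smul ((hQ.2.mul_mul_conjTranspose_same _).add
    (hQ.1.mul_mul_conjTranspose_same _))

/-- One half of the variational characterisation of the trace norm. In an orthonormal basis of
right singular vectors of `A`, each diagonal entry of `Q * A` is bounded by a singular value. -/
theorem re_trace_mul_le_traceNorm {Q A : Matrix X X ℂ} (hQ : IsObservable Q) :
    (Q * A).trace.re ≤ traceNorm A := by
  set hH := isHermitian_conjTranspose_mul_self A
  set U : Matrix X X ℂ := (hH.eigenvectorUnitary : Matrix X X ℂ) with hUdef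
  have hU : Uᴴ * U = 1 := mem_unitaryGroup_iff'.mp hH.eigenvectorUnitary.2
  have hU' : U * Uᴴ = 1 := mem_unitaryGroup_iff.mp hH.eigenvectorUnitary.2
  have hd : (A * U)ᴴ * (A * U) = diagonal (fun i => (hH.eigenvalues i : ℂ)) := by
    have h : Aᴴ * A = U * diagonal (fun i => (hH.eigenvalues i : ℂ)) * Uᴴ := by
      conv_lhs => rw [hH.spectral_theorem, Unitary.conjStarAlgAut_apply]
      rfl
    rw [conjTranspose_mul, show Uᴴ * Aᴴ * (A * U) = Uᴴ * (Aᴴ * A) * U by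
      simp only [Matrix.mul_assoc]]
    refine (congrArg (fun M => Uᴴ * M * U) h).trans ?_
    rw [show Uᴴ * (U * diagonal (fun i => (hH.eigenvalues i : ℂ)) * Uᴴ) * U
        = (Uᴴ * U) * diagonal (fun i => (hH.eigenvalues i : ℂ)) * (Uᴴ * U) by
          simp only [Matrix.mul_assoc], hU, Matrix.one_mul, Matrix.mul_one]
  have hQQ : (1 - (Q * U)ᴴ * (Q * U)).PosSemidef := by
    have e2 : 1 - (Q * U)ᴴ * (Q * U) = Uᴴ * (1 - Q * Q) * U := by
      rw [conjTranspose_mul, hQ.isHermitian.eq, Matrix.mul_sub, Matrix.sub_mul, Matrix.mul_one, hU]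
      simp only [Matrix.mul_assoc]
    rw [e2]
    exact hQ.one_sub_mul_self.conjTranspose_mul_mul_same U
  have htr : (Q * A).trace = ∑ i, ∑ j, star ((Q * U) j i) * (A * U) j i := by
    have : (Q * A).trace = ((Q * U)ᴴ * (A * U)).trace := by
      rw [conjTranspose_mul, hQ.isHermitian.eq, show Uᴴ * Q * (A * U) = Uᴴ * (Q * A * U) by
        simp only [Matrix.mul_assoc], trace_mul_comm Uᴴ, Matrix.mul_assoc (Q * A), hU',
        Matrix.mul_one]
    rw [this]
    simp only [trace, diag, Matrix.mul_apply, conjTranspose_apply]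
  rw [htr, Complex.re_sum]
  refine Finset.sum_le_sum fun i _ => ?_
  have hv := congrFun (congrFun hd i) i
  have hw := hQQ.diag_nonneg (i := i)
  rw [diagonal_apply_eq] at hv
  have n1 : ∀ B : Matrix X X ℂ, (Bᴴ * B) i i =
      ((‖WithLp.toLp 2 (fun j => B j i)‖ ^ 2 : ℝ) : ℂ) := by
    intro B
    rw [EuclideanSpace.norm_sq_eq]
    simp only [Matrix.mul_apply, conjTranspose_apply, Complex.ofReal_sum, RCLike.star_def,
      Complex.conj_mul', Complex.ofReal_pow]
  have hv' : ‖WithLp.toLp 2 (fun j => (A * U) j i)‖ ^ 2 = hH.eigenvalues i := by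
    rw [n1] at hv
    exact_mod_cast hv
  have hw' : ‖WithLp.toLp 2 (fun j => (Q * U) j i)‖ ^ 2 ≤ 1 := by
    rw [Matrix.sub_apply, one_apply_eq, n1, sub_nonneg] at hw
    exact_mod_cast hw
  have hw1 : ‖WithLp.toLp 2 (fun j => (Q * U) j i)‖ ≤ 1 := by
    nlinarith [norm_nonneg (WithLp.toLp 2 (fun j => (Q * U) j i))]
  have hcs := norm_inner_le_norm (𝕜 := ℂ) (WithLp.toLp 2 (fun j => (Q * U) j i))
    (WithLp.toLp 2 (fun j => (A * U) j i))
  rw [← hv', Real.sqrt_sq (norm_nonneg _)]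
  calc _ ≤ ‖∑ j, star ((Q * U) j i) * (A * U) j i‖ := Complex.re_le_norm _
    _ = ‖inner ℂ (WithLp.toLp 2 (fun j => (Q * U) j i))
        (WithLp.toLp 2 (fun j => (A * U) j i))‖ := by
        rw [PiLp.inner_apply]
        simp [mul_comm]
    _ ≤ _ := hcs
    _ ≤ _ := mul_le_of_le_one_left (norm_nonneg _) hw1

/-- The probabilities that an effect `E` assigns to two operators of equal trace differ by at most
their trace distance. -/
theorem re_trace_mul_sub_le_traceDist {E A B : Matrix X X ℂ} (hE : E.PosSemidef)
    (hE' : (1 - E).PosSemidef) (h : A.trace = B.trace) :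
    (E * A).trace.re - (E * B).trace.re ≤ traceDist A B := by
  have hQ : IsObservable ((2 : ℂ) • E - 1) := by
    have two : (0 : ℂ) ≤ 2 := by rw [Complex.nonneg_iff]; norm_num
    constructor
    · convert hE'.smul two using 1
      module
    · convert hE.smul two using 1
      module
  have := re_trace_mul_le_traceNorm (A := A - B) hQ
  have e : (((2 : ℂ) • E - 1) * (A - B)).trace = 2 * ((E * A).trace - (E * B).trace) := by
    rw [Matrix.sub_mul, Matrix.one_mul, Matrix.smul_mul, Matrix.mul_sub, trace_sub, trace_smul,
      trace_sub, trace_sub, h, smul_eq_mul, sub_self, sub_zero]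
  rw [e] at this
  simp only [Complex.mul_re, Complex.re_ofNat, Complex.im_ofNat, zero_mul, sub_zero,
    Complex.sub_re] at this
  unfold traceDist
  linarith

/-- The Powers–Størmer inequality `Tr (S - T)² ≤ ‖S² - T²‖₁`, with the observable that witnesses
it: the sign of `S - T`. -/
theorem exists_observable_powers_stormer {S T : Matrix X X ℂ} (hS : S.PosSemidef)
    (hT : T.PosSemidef) :
    ∃ Q : Matrix X X ℂ, IsObservable Q ∧
      ((S - T) * (S - T)).trace.re ≤ (Q * (S * S - T * T)).trace.re := by
  obtain ⟨U, d, hU, hU', hD⟩ := exists_unitary_mul_diagonal (hS.1.sub hT.1)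
  refine ⟨U * diagonal (fun i => ((SignType.sign (d i) : ℝ) : ℂ)) * Uᴴ, ⟨?_, ?_⟩, ?_⟩
  · have e : 1 - U * diagonal (fun i => ((SignType.sign (d i) : ℝ) : ℂ)) * Uᴴ =
        U * diagonal (fun i => ((1 - (SignType.sign (d i) : ℝ) : ℝ) : ℂ)) * Uᴴ := by
      simp only [Complex.ofReal_sub, ← diagonal_sub, Matrix.mul_sub, Matrix.sub_mul,
        Complex.ofReal_one, diagonal_one, Matrix.mul_one, hU']
    rw [e]
    refine posSemidef_conj_diagonal U fun i => ?_
    rcases lt_trichotomy (d i) 0 with h | h | h <;> simp [h]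
  · have e : 1 + U * diagonal (fun i => ((SignType.sign (d i) : ℝ) : ℂ)) * Uᴴ =
        U * diagonal (fun i => ((1 + (SignType.sign (d i) : ℝ) : ℝ) : ℂ)) * Uᴴ := by
      simp only [Complex.ofReal_add, ← diagonal_add, Matrix.mul_add, Matrix.add_mul,
        Complex.ofReal_one, diagonal_one, Matrix.mul_one, hU']
    rw [e]
    refine posSemidef_conj_diagonal U fun i => ?_
    rcases lt_trichotomy (d i) 0 with h | h | h <;> simp [h]
  · -- in an eigenbasis of `S - T` the inequality reads `∑ dᵢ² ≤ ∑ |dᵢ| (Sᵢᵢ + Tᵢᵢ)`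
    set S' := Uᴴ * S * U with hS'
    set T' := Uᴴ * T * U with hT'
    have hST : S' - T' = diagonal (fun i => (d i : ℂ)) := by
      rw [hS', hT', ← Matrix.sub_mul, ← Matrix.mul_sub, hD,
        show Uᴴ * (U * diagonal (fun i => (d i : ℂ)) * Uᴴ) * U
          = (Uᴴ * U) * diagonal (fun i => (d i : ℂ)) * (Uᴴ * U) by
            simp only [Matrix.mul_assoc], hU, Matrix.one_mul, Matrix.mul_one]
    have lhs : ((S - T) * (S - T)).trace = ∑ i, (d i : ℂ) * d i := by
      rw [hD, conj_diagonal_mul hU, trace_mul_cycle, hU, Matrix.one_mul, trace_diagonal]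
      simp
    have cut : ∀ M : Matrix X X ℂ, Uᴴ * (M * M) * U = (Uᴴ * M * U) * (Uᴴ * M * U) := fun M => by
      rw [show (Uᴴ * M * U) * (Uᴴ * M * U) = Uᴴ * (M * (U * Uᴴ) * M) * U by
        simp only [Matrix.mul_assoc], hU', Matrix.mul_one]
    have split : S' * S' - T' * T' = (1 / 2 : ℂ) •
        ((S' - T') * (S' + T') + (S' + T') * (S' - T')) := by
      simp only [Matrix.sub_mul, Matrix.mul_sub, Matrix.add_mul, Matrix.mul_add]
      module
    have rhs : (U * diagonal (fun i => ((SignType.sign (d i) : ℝ) : ℂ)) * Uᴴ *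
        (S * S - T * T)).trace =
        ∑ i, ((SignType.sign (d i) : ℝ) : ℂ) * (d i * (S' i i + T' i i)) := by
      rw [show U * diagonal (fun i => ((SignType.sign (d i) : ℝ) : ℂ)) * Uᴴ * (S * S - T * T)
        = U * (diagonal (fun i => ((SignType.sign (d i) : ℝ) : ℂ)) * (Uᴴ * (S * S - T * T))) by
          simp only [Matrix.mul_assoc], trace_mul_comm, Matrix.mul_assoc, Matrix.mul_sub,
          Matrix.sub_mul, cut S, cut T, ← hS', ← hT', split, hST]
      simp only [trace, diag, diagonal_mul, Matrix.smul_apply, Matrix.add_apply, mul_diagonal,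
        smul_eq_mul]
      refine Finset.sum_congr rfl fun i _ => ?_
      ring
    rw [lhs, rhs, Complex.re_sum, Complex.re_sum]
    refine Finset.sum_le_sum fun i _ => ?_
    have hSi := (Complex.nonneg_iff.mp ((hS.conjTranspose_mul_mul_same U).diag_nonneg (i := i))).1
    have hTi := (Complex.nonneg_iff.mp ((hT.conjTranspose_mul_mul_same U).diag_nonneg (i := i))).1
    have hdi : (S' i i).re - (T' i i).re = d i := by
      have := congrArg Complex.re (congrFun (congrFun hST i) i)
      rwa [Matrix.sub_apply, Complex.sub_re, diagonal_apply_eq, Complex.ofReal_re] at this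
    rw [← hS'] at hSi
    rw [← hT'] at hTi
    rw [Complex.re_ofReal_mul, Complex.re_ofReal_mul, Complex.re_ofReal_mul, Complex.ofReal_re,
      Complex.add_re, ← mul_assoc, _root_.sign_mul_self]
    rw [← abs_mul_abs_self (d i)]
    exact mul_le_mul_of_nonneg_left (abs_le.2 ⟨by linarith, by linarith⟩) (abs_nonneg _)

end Observable

/-! ### Continuity of outcome probabilities -/

section Frobenius

variable {Y W : Type*} [Fintype Y] [Fintype W]

attribute [local instance] Matrix.frobeniusNormedAddCommGroup

theorem frobenius_norm_sq (A : Matrix Y W ℂ) : ‖A‖ ^ 2 = (Aᴴ * A).trace.re := by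
  rw [frobenius_norm_def, ← Real.sqrt_eq_rpow, Real.sq_sqrt (by positivity)]
  simp only [trace, diag, Matrix.mul_apply, conjTranspose_apply, RCLike.star_def,
    Complex.conj_mul', Complex.re_sum, ← Complex.ofReal_pow, Complex.ofReal_re, Real.rpow_two]
  rw [Finset.sum_comm]

/-- The probability of an effect `P` is continuous in the purified, possibly subnormalised state
`u`. Writing `P = g† g`, it is the square of the norm of `g u`, and `g` is a contraction. -/
theorem effect_sub_le [DecidableEq Y] {P : Matrix Y Y ℂ} (hP : P.PosSemidef)
    (hP' : (1 - P).PosSemidef) {u v : Matrix Y W ℂ} (hu : (uᴴ * u).trace.re ≤ 1)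
    (hv : (vᴴ * v).trace.re ≤ 1) :
    (uᴴ * P * u).trace.re - (vᴴ * P * v).trace.re ≤ 2 * √(((u - v)ᴴ * (u - v)).trace.re) := by
  obtain ⟨g, rfl⟩ := exists_eq_conjTranspose_mul_self hP
  have key : ∀ w : Matrix Y W ℂ, (wᴴ * (gᴴ * g) * w).trace.re = ‖g * w‖ ^ 2 := fun w => by
    rw [frobenius_norm_sq, conjTranspose_mul]
    simp only [Matrix.mul_assoc]
  have contr : ∀ w : Matrix Y W ℂ, ‖g * w‖ ≤ ‖w‖ := fun w => by
    refine abs_le_of_sq_le_sq' ?_ (norm_nonneg _) |>.2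
    rw [← key, frobenius_norm_sq]
    have := re_trace_nonneg (hP'.conjTranspose_mul_mul_same w)
    rw [Matrix.mul_sub, Matrix.sub_mul, Matrix.mul_one, trace_sub, Complex.sub_re] at this
    linarith
  have h1 : ‖u‖ ≤ 1 := by
    rw [← frobenius_norm_sq] at hu
    nlinarith [norm_nonneg u]
  have h2 : ‖v‖ ≤ 1 := by
    rw [← frobenius_norm_sq] at hv
    nlinarith [norm_nonneg v]
  rw [← frobenius_norm_sq, Real.sqrt_sq (norm_nonneg _), key, key]
  have h3 := contr u
  have h4 := contr v
  have h5 := contr (u - v)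
  have h6 : ‖g * u‖ - ‖g * v‖ ≤ ‖g * (u - v)‖ := by
    rw [Matrix.mul_sub]
    exact norm_sub_norm_le _ _
  nlinarith [norm_nonneg (g * u), norm_nonneg (g * v), norm_nonneg (u - v)]

end Frobenius

/-! ### Correlations with a purifying party -/

section Attack

variable {Y B : Type*} [Fintype Y] [DecidableEq Y] [Fintype B] [DecidableEq B]

/-- Let `N` describe a pure state on two parties `Y` and `B`, so that `τ = N† N` is the (transposed)
reduced state on `B`. If `τ` is hardly changed by conjugation with the involution `Z`, then some
observable `H` on `Y` is almost perfectly correlated with `Z`. Here `H = V Z V†`, where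
`N = V √τ` is a polar decomposition, and the correlation `Tr (Z √τ Z √τ)` is bounded by the
Powers–Størmer inequality for `√τ` and `Z √τ Z`. -/
theorem exists_correlated_observable (N : Matrix Y B ℂ) {Z : Matrix B B ℂ} (hZ : Z.IsHermitian)
    (hZZ : Z * Z = 1) :
    ∃ (H : Matrix Y Y ℂ) (Q : Matrix B B ℂ), IsObservable H ∧ IsObservable Q ∧
      (Nᴴ * N).trace.re - 1 / 2 * (Q * (Nᴴ * N - Z * (Nᴴ * N) * Z)).trace.re ≤
        (Z * (Nᴴ * H * N)).trace.re := by
  obtain ⟨S, T, hS, hT, hSS, hTτ, hTTS⟩ :=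
    exists_sqrt_and_pinv (posSemidef_conjTranspose_mul_self N)
  set τ := Nᴴ * N with hτ
  have hZo := isObservable_of_sq_eq_one hZ hZZ
  have hZS : (Z * S * Z).PosSemidef := by
    have := hS.mul_mul_conjTranspose_same Z
    rwa [hZ.eq] at this
  obtain ⟨Q, hQ, hPS⟩ := exists_observable_powers_stormer hS hZS
  have hτT : τ * T = S := by
    have := congrArg conjTranspose hTτ
    rwa [conjTranspose_mul, hT.1.eq, hS.1.eq, hτ, conjTranspose_mul, conjTranspose_conjTranspose,
      ← hτ] at this
  -- the partial isometry of the polar decomposition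
  set V := N * T with hV
  have hVV : V * Vᴴ * (V * Vᴴ) = V * Vᴴ := by
    have h1 : Vᴴ * V = T * S := by
      rw [hV, conjTranspose_mul, hT.1.eq, show T * Nᴴ * (N * T) = T * (τ * T) by
        rw [hτ]; simp only [Matrix.mul_assoc], hτT]
    rw [show V * Vᴴ * (V * Vᴴ) = V * (Vᴴ * V) * Vᴴ by simp only [Matrix.mul_assoc], h1, hV,
      show N * T * (T * S) = N * (T * (T * S)) by simp only [Matrix.mul_assoc]]
    rw [hTTS]
  have hP : (1 - V * Vᴴ).PosSemidef := by
    have e : 1 - V * Vᴴ = (1 - V * Vᴴ)ᴴ * (1 - V * Vᴴ) := by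
      rw [conjTranspose_sub, conjTranspose_one, (isHermitian_mul_conjTranspose_self V).eq,
        Matrix.sub_mul, Matrix.mul_sub, Matrix.mul_sub, hVV]
      simp
    rw [e]
    exact posSemidef_conjTranspose_mul_self _
  refine ⟨V * Z * Vᴴ, Q, ⟨?_, ?_⟩, hQ, ?_⟩
  · have e : 1 - V * Z * Vᴴ = (1 - V * Vᴴ) + V * (1 - Z) * Vᴴ := by
      rw [Matrix.mul_sub, Matrix.sub_mul, Matrix.mul_one]
      abel
    rw [e]
    exact hP.add (hZo.1.mul_mul_conjTranspose_same V)
  · have e : 1 + V * Z * Vᴴ = (1 - V * Vᴴ) + V * (1 + Z) * Vᴴ := by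
      rw [Matrix.mul_add, Matrix.add_mul, Matrix.mul_one]
      abel
    rw [e]
    exact hP.add (hZo.2.mul_mul_conjTranspose_same V)
  · have hNV : Nᴴ * V = S := by rw [hV, ← Matrix.mul_assoc, ← hτ, hτT]
    have hVN : Vᴴ * N = S := by
      have := congrArg conjTranspose hNV
      rwa [conjTranspose_mul, conjTranspose_conjTranspose, hS.1.eq] at this
    have e1 : Z * (Nᴴ * (V * Z * Vᴴ) * N) = Z * S * Z * S := by
      rw [show Z * (Nᴴ * (V * Z * Vᴴ) * N) = Z * (Nᴴ * V) * Z * (Vᴴ * N) by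
        simp only [Matrix.mul_assoc], hNV, hVN]
    have e3 : Z * S * Z * (Z * S * Z) = Z * τ * Z := by
      rw [show Z * S * Z * (Z * S * Z) = Z * S * (Z * Z) * S * Z by
        simp only [Matrix.mul_assoc], hZZ, Matrix.mul_one, Matrix.mul_assoc Z, hSS]
    have e4 : (Z * τ * Z).trace = τ.trace := by
      rw [trace_mul_cycle, hZZ, Matrix.one_mul]
    have e2 : ((S - Z * S * Z) * (S - Z * S * Z)).trace =
        2 * τ.trace - 2 * (Z * S * Z * S).trace := by
      rw [Matrix.sub_mul, Matrix.mul_sub, Matrix.mul_sub, trace_sub, trace_sub, trace_sub, e3, e4,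
        hSS, trace_mul_comm S]
      ring
    rw [e2, e3, hSS] at hPS
    rw [e1]
    simp only [Complex.sub_re, Complex.mul_re, Complex.re_ofNat, Complex.im_ofNat, zero_mul,
      sub_zero] at hPS
    linarith

/-- If some observable `C` on `Y` is almost perfectly correlated with the involution `Z` on `B`,
then the reduced state on `B` is hardly changed by conjugation with `Z`: the vectors of `N Z` and
`C N` nearly agree, and `C` acts on the other party. -/
theorem re_trace_observable_conj_le {N : Matrix Y B ℂ} {Z : Matrix B B ℂ} (hZ : Z.IsHermitian)
    (hZZ : Z * Z = 1) (hN : (Nᴴ * N).trace = 1) {C : Matrix Y Y ℂ} (hC : IsObservable C) {ε : ℝ}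
    (h : 1 - 2 * ε ≤ (Z * (Nᴴ * C * N)).trace.re) {Q : Matrix B B ℂ} (hQ : IsObservable Q) :
    (Q * (Nᴴ * N - Z * (Nᴴ * N) * Z)).trace.re ≤ 8 * √ε := by
  set τ := Nᴴ * N with hτ
  have hCh := hC.isHermitian
  set P := (1 / 2 : ℂ) • (1 - Q) with hPdef
  have hP : P.PosSemidef := posSemidef_half_smul hQ.1
  have hP' : (1 - P).PosSemidef := by
    convert posSemidef_half_smul hQ.2 using 1
    rw [hPdef]
    module
  have eu : (N * Z) * (N * Z)ᴴ = N * Nᴴ := by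
    rw [conjTranspose_mul, hZ.eq, show N * Z * (Z * Nᴴ) = N * (Z * Z) * Nᴴ by
      simp only [Matrix.mul_assoc], hZZ, Matrix.mul_one]
  have tu : ((N * Z) * (N * Z)ᴴ).trace = 1 := by rw [eu, trace_mul_comm, ← hτ, hN]
  have hCC := hC.one_sub_mul_self
  have dv : ∀ R : Matrix B B ℂ, ((C * N) * R * (C * N)ᴴ).trace =
      (R * τ).trace - (R * (Nᴴ * (1 - C * C) * N)).trace := fun R => by
    rw [conjTranspose_mul, hCh.eq, Matrix.mul_sub, Matrix.sub_mul, Matrix.mul_sub, trace_sub,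
      Matrix.mul_one, ← hτ, trace_mul_comm, show Nᴴ * C * (C * N * R) = Nᴴ * (C * C) * N * R by
        simp only [Matrix.mul_assoc], trace_mul_comm _ R]
    ring
  have tv : ((C * N) * (C * N)ᴴ).trace.re ≤ 1 := by
    have := dv 1
    rw [Matrix.mul_one, Matrix.one_mul, Matrix.one_mul, hN] at this
    rw [this, Complex.sub_re, Complex.one_re]
    linarith [re_trace_nonneg (hCC.conjTranspose_mul_mul_same N)]
  have key := effect_sub_le (u := (N * Z)ᴴ) (v := (C * N)ᴴ) hP hP'
    (by rw [conjTranspose_conjTranspose, tu, Complex.one_re])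
    (by rwa [conjTranspose_conjTranspose])
  rw [conjTranspose_conjTranspose, conjTranspose_conjTranspose, ← conjTranspose_sub,
    conjTranspose_conjTranspose] at key
  have hdist : ((N * Z - C * N) * (N * Z - C * N)ᴴ).trace.re ≤ 2 ^ 2 * ε := by
    have c1 : ((N * Z) * (C * N)ᴴ).trace = (Z * (Nᴴ * C * N)).trace := by
      rw [conjTranspose_mul, hCh.eq, show N * Z * (Nᴴ * C) = N * (Z * (Nᴴ * C)) by
        simp only [Matrix.mul_assoc], trace_mul_comm]
      simp only [Matrix.mul_assoc]
    have c2 : ((C * N) * (N * Z)ᴴ).trace.re = (Z * (Nᴴ * C * N)).trace.re := by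
      rw [← c1, show (C * N) * (N * Z)ᴴ = ((N * Z) * (C * N)ᴴ)ᴴ by
        rw [conjTranspose_mul (N * Z), conjTranspose_conjTranspose], trace_conjTranspose]
      simp
    rw [conjTranspose_sub, Matrix.sub_mul, Matrix.mul_sub, Matrix.mul_sub, trace_sub, trace_sub,
      trace_sub, tu, c1]
    simp only [Complex.sub_re, Complex.one_re, c2]
    linarith
  have hsq := Real.sqrt_le_sqrt hdist
  rw [Real.sqrt_mul (by norm_num), Real.sqrt_sq (by norm_num)] at hsq
  have ku : ((N * Z) * P * (N * Z)ᴴ).trace = (P * (Z * τ * Z)).trace := by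
    rw [conjTranspose_mul, hZ.eq, trace_mul_comm, hτ, show Z * Nᴴ * (N * Z * P)
      = Z * (Nᴴ * N) * Z * P by simp only [Matrix.mul_assoc], trace_mul_comm]
  have kv := re_trace_mul_nonneg hP (hCC.conjTranspose_mul_mul_same N)
  rw [ku, dv P, Complex.sub_re] at key
  have e4 : (Z * τ * Z).trace = τ.trace := by
    rw [trace_mul_cycle, hZZ, Matrix.one_mul]
  have fin : (Q * (τ - Z * τ * Z)).trace = 2 * ((P * (Z * τ * Z)).trace - (P * τ).trace) := by
    rw [hPdef, Matrix.smul_mul, Matrix.smul_mul, trace_smul, trace_smul, Matrix.sub_mul,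
      Matrix.sub_mul, Matrix.mul_sub, trace_sub, trace_sub, trace_sub, Matrix.one_mul,
      Matrix.one_mul, e4, smul_eq_mul, smul_eq_mul]
    ring
  rw [fin]
  simp only [Complex.sub_re, Complex.mul_re, Complex.re_ofNat, Complex.im_ofNat, zero_mul,
      sub_zero]
  linarith

/-- If the reduced states on `B` of two pure states are close, and in the second one the bit `Z`
can be read off from the other party, then the bit is also accessible in the first one. -/
theorem exists_observable_of_indistinguishable {N₀ N₁ : Matrix Y B ℂ} {Z : Matrix B B ℂ}
    (hZ : Z.IsHermitian) (hZZ : Z * Z = 1) (h₀ : (N₀ᴴ * N₀).trace = 1)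
    (h₁ : (N₁ᴴ * N₁).trace = 1) {C : Matrix Y Y ℂ} (hC : IsObservable C) {ε δ : ℝ}
    (hcorr : 1 - 2 * ε ≤ (Z * (N₁ᴴ * C * N₁)).trace.re)
    (hpriv : ∀ Q : Matrix B B ℂ, IsObservable Q →
      (Q * (N₀ᴴ * N₀ - N₁ᴴ * N₁)).trace.re ≤ 2 * δ) :
    ∃ H : Matrix Y Y ℂ, IsObservable H ∧
      1 - 2 * δ - 4 * √ε ≤ (Z * (N₀ᴴ * H * N₀)).trace.re := by
  obtain ⟨H, Q, hH, hQ, h⟩ := exists_correlated_observable N₀ hZ hZZ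
  refine ⟨H, hH, ?_⟩
  have h2 := re_trace_observable_conj_le hZ hZZ h₁ hC hcorr hQ
  set Q' := (1 / 2 : ℂ) • (Q - Z * Q * Z) with hQ'
  have hcj : ∀ R : Matrix B B ℂ, R.PosSemidef → (Z * R * Z).PosSemidef := fun R hR => by
    have := hR.mul_mul_conjTranspose_same Z
    rwa [hZ.eq] at this
  have hQo : IsObservable Q' := by
    constructor
    · have e : 1 - Q' = (1 / 2 : ℂ) • ((1 - Q) + Z * (1 + Q) * Z) := by
        rw [hQ', Matrix.mul_add, Matrix.add_mul, Matrix.mul_one, hZZ]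
        module
      rw [e]
      exact posSemidef_half_smul (hQ.1.add (hcj _ hQ.2))
    · have e : 1 + Q' = (1 / 2 : ℂ) • ((1 + Q) + Z * (1 - Q) * Z) := by
        rw [hQ', Matrix.mul_sub, Matrix.sub_mul, Matrix.mul_one, hZZ]
        module
      rw [e]
      exact posSemidef_half_smul (hQ.2.add (hcj _ hQ.1))
  have h3 := hpriv Q' hQo
  have tw : ∀ τ : Matrix B B ℂ, (Q * (τ - Z * τ * Z)).trace = 2 * (Q' * τ).trace := fun τ => by
    rw [hQ', Matrix.smul_mul, trace_smul, Matrix.mul_sub, Matrix.sub_mul, trace_sub, trace_sub,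
      show Q * (Z * τ * Z) = (Q * (Z * τ)) * Z by simp only [Matrix.mul_assoc], trace_mul_comm _ Z,
      smul_eq_mul, show Z * (Q * (Z * τ)) = Z * Q * Z * τ by simp only [Matrix.mul_assoc]]
    ring
  rw [tw] at h h2
  rw [Matrix.mul_sub, trace_sub, Complex.sub_re] at h3
  rw [h₀] at h
  simp only [Complex.mul_re, Complex.re_ofNat, Complex.im_ofNat, zero_mul, sub_zero,
    Complex.one_re] at h h2
  linarith

end Attack

/-! ### Reading one bit after the other -/

section Reading

/-- The observable `(-1) ^ β i` of the register `i`. -/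
noncomputable def bitObservable {I : Type*} [DecidableEq I] (J : Type*) [DecidableEq J]
    (β : I → ZMod 2) :
    Matrix (I × J) (I × J) ℂ :=
  diagonal fun b => sign (β b.1)

theorem isHermitian_bitObservable {I J : Type*} [DecidableEq I] [DecidableEq J]
    (β : I → ZMod 2) : (bitObservable J β).IsHermitian := by
  rw [bitObservable, IsHermitian, diagonal_conjTranspose]
  congr 1
  funext b
  exact star_sign _

variable {I J Y : Type*} [Fintype I] [DecidableEq I] [Fintype J] [DecidableEq J] [Fintype Y]

theorem bit_cases (t : ZMod 2) : t = 0 ∨ t = 1 := by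
  revert t
  decide

theorem sum_bits {M : Type*} [AddCommMonoid M] (f : ZMod 2 → M) : ∑ t, f t = f 0 + f 1 :=
  Fin.sum_univ_two f

@[simp]
theorem sign_zero : sign 0 = 1 := by simp [sign]

@[simp]
theorem sign_one : sign 1 = -1 := by
  rw [sign, show (1 : ZMod 2).val = 1 from rfl, pow_one]

/-- The effect of the outcome `t` when the observable `H`, whose values `1` and `-1` encode the bits
`0` and `1`, is measured as a bit. -/
noncomputable def effect {Y : Type*} [DecidableEq Y] (H : Matrix Y Y ℂ) (t : ZMod 2) :
    Matrix Y Y ℂ :=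
  (1 / 2 : ℂ) • (1 + sign t • H)

theorem effect_zero_add_one {Y : Type*} [DecidableEq Y] (H : Matrix Y Y ℂ) :
    effect H 0 + effect H 1 = 1 := by
  simp only [effect, sign_zero, sign_one]
  module

/-- The uniform superposition over `i : I` of the states described by the matrices `A i`: party `B`
holds the register `i` and the environment `j : J`. -/
noncomputable def superposition (A : I → Matrix Y J ℂ) : Matrix Y (I × J) ℂ :=
  Matrix.of fun y b => (((√(Fintype.card I))⁻¹ : ℝ) : ℂ) * A b.1 y b.2

theorem bitObservable_mul_self (β : I → ZMod 2) :
    bitObservable J β * bitObservable J β = 1 := by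
  rw [bitObservable, diagonal_mul_diagonal]
  simp only [sign_mul_self, diagonal_one]

theorem trace_bitObservable_superposition (A : I → Matrix Y J ℂ) (β : I → ZMod 2)
    (H : Matrix Y Y ℂ) :
    (bitObservable J β * ((superposition A)ᴴ * H * superposition A)).trace =
      (Fintype.card I : ℂ)⁻¹ * ∑ i, sign (β i) * ((A i)ᴴ * H * A i).trace := by
  have hc : (((√(Fintype.card I))⁻¹ : ℝ) : ℂ) * (((√(Fintype.card I))⁻¹ : ℝ) : ℂ) =
      (Fintype.card I : ℂ)⁻¹ := by
    rw [← Complex.ofReal_mul, ← mul_inv, Real.mul_self_sqrt (Nat.cast_nonneg _)]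
    simp
  rw [bitObservable, trace, Fintype.sum_prod_type, Finset.mul_sum]
  refine Finset.sum_congr rfl fun i _ => ?_
  rw [trace, Finset.mul_sum, Finset.mul_sum]
  refine Finset.sum_congr rfl fun j _ => ?_
  rw [diag_apply, diagonal_mul, diag_apply]
  simp only [Matrix.mul_apply, conjTranspose_apply, superposition, of_apply,
    star_mul', RCLike.star_def, Complex.conj_ofReal, Finset.mul_sum, Finset.sum_mul]
  refine Finset.sum_congr rfl fun y _ => Finset.sum_congr rfl fun y' _ => ?_
  rw [← hc]
  ring

theorem trace_superposition [Nonempty I] [DecidableEq Y] (A : I → Matrix Y J ℂ)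
    (hA : ∀ i, ((A i)ᴴ * A i).trace = 1) :
    ((superposition A)ᴴ * superposition A).trace = 1 := by
  have h := trace_bitObservable_superposition A (fun _ => 0) 1
  have hZ : bitObservable (I := I) J (fun _ => 0) = 1 := by
    simp [bitObservable]
  rw [hZ] at h
  simpa [hA] using h

theorem IsObservable.posSemidef_effect [DecidableEq Y] {H : Matrix Y Y ℂ} (hH : IsObservable H)
    (t : ZMod 2) : (effect H t).PosSemidef := by
  refine posSemidef_half_smul ?_
  rcases bit_cases t with rfl | rfl
  · simpa using hH.2
  · simpa [sub_eq_add_neg] using hH.1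

theorem one_sub_effect {Y : Type*} [DecidableEq Y] (H : Matrix Y Y ℂ) (t : ZMod 2) :
    1 - effect H t = effect H (t + 1) := by
  rw [sub_eq_iff_eq_add, ← effect_zero_add_one H]
  rcases bit_cases t with rfl | rfl
  · simp [add_comm]
  · simp [show (1 + 1 : ZMod 2) = 0 from rfl]

/-- Reading one bit after the other. In the states `A₀ i` the measurement `M₀` returns `β₀ i`, and
in the states `A₁ i` the measurement `M₁` returns `β₁ i`, up to an error `ε`. If a party `B` with
the superposition of the `i` cannot tell the two families apart, then a single measurement `E` of
the states `A₀ i` yields both bits: it first measures `M₀`, which hardly disturbs the state, and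
then an observable for the second bit. -/
theorem exists_joint_measurement [Nonempty I] [DecidableEq Y] {A₀ A₁ : I → Matrix Y J ℂ}
    (h₀ : ∀ i, ((A₀ i)ᴴ * A₀ i).trace = 1) (h₁ : ∀ i, ((A₁ i)ᴴ * A₁ i).trace = 1)
    {M₀ M₁ : ZMod 2 → Matrix Y Y ℂ} (hM₀ : ∀ t, (M₀ t).PosSemidef) (hM₁ : ∀ t, (M₁ t).PosSemidef)
    (hM₀' : M₀ 0 + M₀ 1 = 1) (hM₁' : M₁ 0 + M₁ 1 = 1) {β₀ β₁ : I → ZMod 2} {ε δ : ℝ}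
    (hc₀ : ∀ i, 1 - ε ≤ ((A₀ i)ᴴ * M₀ (β₀ i) * A₀ i).trace.re)
    (hc₁ : ∀ i, 1 - ε ≤ ((A₁ i)ᴴ * M₁ (β₁ i) * A₁ i).trace.re)
    (hpriv : ∀ Q : Matrix (I × J) (I × J) ℂ, IsObservable Q →
      (Q * ((superposition A₀)ᴴ * superposition A₀ -
        (superposition A₁)ᴴ * superposition A₁)).trace.re ≤ 2 * δ) :
    ∃ E : ZMod 2 → ZMod 2 → Matrix Y Y ℂ, (∀ s t, (E s t).PosSemidef) ∧
      (1 - ∑ s, ∑ t, E s t).PosSemidef ∧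
      1 - δ - 4 * √ε ≤
        (Fintype.card I : ℝ)⁻¹ * ∑ i, ((A₀ i)ᴴ * E (β₀ i) (β₁ i) * A₀ i).trace.re := by
  have hcard : (0 : ℝ) < Fintype.card I := Nat.cast_pos.2 Fintype.card_pos
  -- the observable of the second bit
  set C := M₁ 0 - M₁ 1 with hC
  have hC0 : 1 - C = (2 : ℂ) • M₁ 1 := by rw [← hM₁', hC]; module
  have hC1 : 1 + C = (2 : ℂ) • M₁ 0 := by rw [← hM₁', hC]; module
  have two : (0 : ℂ) ≤ 2 := by rw [Complex.nonneg_iff]; norm_num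
  have hCo : IsObservable C := ⟨hC0 ▸ (hM₁ 1).smul two, hC1 ▸ (hM₁ 0).smul two⟩
  have average : ∀ (A : I → Matrix Y J ℂ) (H : Matrix Y Y ℂ),
      (bitObservable J β₁ * ((superposition A)ᴴ * H * superposition A)).trace.re =
      (Fintype.card I : ℝ)⁻¹ * ∑ i, (sign (β₁ i) * ((A i)ᴴ * H * A i).trace).re := fun A H => by
    rw [trace_bitObservable_superposition, ← Complex.re_sum, ← Complex.re_ofReal_mul]
    simp
  have hcorr : 1 - 2 * ε ≤
      (bitObservable J β₁ * ((superposition A₁)ᴴ * C * superposition A₁)).trace.re := by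
    rw [average]
    have : ∀ i ∈ Finset.univ, 1 - 2 * ε ≤ (sign (β₁ i) * ((A₁ i)ᴴ * C * A₁ i).trace).re := by
      intro i _
      have hs : sign (β₁ i) * ((A₁ i)ᴴ * C * A₁ i).trace =
          2 * ((A₁ i)ᴴ * M₁ (β₁ i) * A₁ i).trace - 1 := by
        rw [← h₁ i]
        rcases bit_cases (β₁ i) with h | h
        · rw [h, sign_zero, show C = (2 : ℂ) • M₁ 0 - 1 by rw [← hC1]; abel, Matrix.mul_sub,
            Matrix.sub_mul, Matrix.mul_smul, Matrix.smul_mul, trace_sub, trace_smul, Matrix.mul_one,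
            smul_eq_mul]
          ring
        · rw [h, sign_one, show C = 1 - (2 : ℂ) • M₁ 1 by rw [← hC0]; abel, Matrix.mul_sub,
            Matrix.sub_mul, Matrix.mul_smul, Matrix.smul_mul, trace_sub, trace_smul, Matrix.mul_one,
            smul_eq_mul]
          ring
      rw [hs]
      have := hc₁ i
      simp only [Complex.sub_re, Complex.mul_re, Complex.re_ofNat, Complex.im_ofNat, zero_mul,
        sub_zero, Complex.one_re]
      linarith
    have := Finset.sum_le_sum this
    rw [Finset.sum_const, Finset.card_univ, nsmul_eq_mul] at this
    rwa [le_inv_mul_iff₀ hcard]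
  obtain ⟨H, hH, h⟩ := exists_observable_of_indistinguishable (isHermitian_bitObservable β₁)
    (bitObservable_mul_self β₁) (trace_superposition A₀ h₀) (trace_superposition A₁ h₁) hCo hcorr
    hpriv
  -- `M₀` itself serves as the measurement operator, in place of its square root; the measurement
  -- need not be complete
  refine ⟨fun s t => M₀ s * effect H t * M₀ s, fun s t => ?_, ?_, ?_⟩
  · have := (hH.posSemidef_effect t).mul_mul_conjTranspose_same (M₀ s)
    rwa [(hM₀ s).1.eq] at this
  · have e : 1 - ∑ s, ∑ t, M₀ s * effect H t * M₀ s =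
        (2 : ℂ) • (M₀ 1 * M₀ 0 * (M₀ 1)ᴴ + M₀ 0 * M₀ 1 * (M₀ 0)ᴴ) := by
      simp only [sum_bits, ← Matrix.add_mul, ← Matrix.mul_add, effect_zero_add_one,
        (hM₀ _).1.eq]
      rw [show M₀ 1 = 1 - M₀ 0 by rw [← hM₀']; abel]
      simp only [Matrix.sub_mul, Matrix.mul_sub, Matrix.one_mul, Matrix.mul_one, Matrix.mul_assoc]
      module
    rw [e]
    exact (((hM₀ 0).mul_mul_conjTranspose_same _).add
      ((hM₀ 1).mul_mul_conjTranspose_same _)).smul two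
  · have gentle : ∀ i ∈ Finset.univ,
        1 / 2 + 1 / 2 * (sign (β₁ i) * ((A₀ i)ᴴ * H * A₀ i).trace).re - 2 * √ε ≤
          ((A₀ i)ᴴ * (M₀ (β₀ i) * effect H (β₁ i) * M₀ (β₀ i)) * A₀ i).trace.re := by
      intro i _
      set M := M₀ (β₀ i) with hM
      have hMp : M.PosSemidef := hM₀ _
      have hMc : (1 - M).PosSemidef := by
        rw [hM, ← hM₀']
        rcases bit_cases (β₀ i) with hb | hb <;> rw [hb]
        · simpa using hM₀ 1
        · simpa using hM₀ 0
      have sq_le : ∀ P : Matrix Y Y ℂ, P.PosSemidef → (1 - P).PosSemidef →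
          (P - P * P).PosSemidef := fun P hP hP' => by
        have e : P - P * P = P * (1 - P) * Pᴴ + (1 - P) * P * (1 - P)ᴴ := by
          rw [conjTranspose_sub, conjTranspose_one, hP.1.eq]
          simp only [Matrix.sub_mul, Matrix.mul_sub, Matrix.one_mul, Matrix.mul_one,
            Matrix.mul_assoc]
          abel
        rw [e]
        exact (hP'.mul_mul_conjTranspose_same _).add (hP.mul_mul_conjTranspose_same _)
      have hv : ((M * A₀ i)ᴴ * (M * A₀ i)).trace.re ≤ 1 := by
        have a1 := re_trace_nonneg (hMc.conjTranspose_mul_mul_same (A₀ i))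
        have a2 := re_trace_nonneg ((sq_le M hMp hMc).conjTranspose_mul_mul_same (A₀ i))
        rw [Matrix.mul_sub, Matrix.sub_mul, trace_sub, Complex.sub_re] at a1 a2
        rw [Matrix.mul_one, h₀ i, Complex.one_re] at a1
        rw [conjTranspose_mul, hMp.1.eq, show (A₀ i)ᴴ * M * (M * A₀ i) =
          (A₀ i)ᴴ * (M * M) * A₀ i by simp only [Matrix.mul_assoc]]
        linarith
      have key := effect_sub_le (P := effect H (β₁ i)) (u := A₀ i) (v := M * A₀ i)
        (hH.posSemidef_effect _) (by rw [one_sub_effect]; exact hH.posSemidef_effect _)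
        (by rw [h₀ i, Complex.one_re]) hv
      have hd : ((A₀ i - M * A₀ i)ᴴ * (A₀ i - M * A₀ i)).trace.re ≤ ε := by
        have a := re_trace_nonneg ((sq_le (1 - M) hMc
          (by rwa [sub_sub_cancel])).conjTranspose_mul_mul_same (A₀ i))
        have c := hc₀ i
        rw [Matrix.mul_sub, Matrix.sub_mul, trace_sub, Complex.sub_re, Matrix.mul_sub,
          Matrix.sub_mul, trace_sub, Matrix.mul_one, h₀ i, Complex.sub_re, Complex.one_re] at a
        have e : (A₀ i - M * A₀ i)ᴴ * (A₀ i - M * A₀ i) =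
            (A₀ i)ᴴ * ((1 - M) * (1 - M)) * A₀ i := by
          rw [show A₀ i - M * A₀ i = (1 - M) * A₀ i by rw [Matrix.sub_mul, Matrix.one_mul],
            conjTranspose_mul, hMc.1.eq]
          simp only [Matrix.mul_assoc]
        rw [e]
        linarith
      have hs := Real.sqrt_le_sqrt hd
      have e1 : ((A₀ i)ᴴ * effect H (β₁ i) * A₀ i).trace =
          (1 / 2 : ℂ) * (1 + sign (β₁ i) * ((A₀ i)ᴴ * H * A₀ i).trace) := by
        rw [effect, Matrix.mul_smul, Matrix.smul_mul, Matrix.mul_add, Matrix.add_mul,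
          Matrix.mul_smul, Matrix.smul_mul, trace_smul, trace_add, trace_smul, Matrix.mul_one,
          h₀ i, smul_eq_mul, smul_eq_mul]
      have e2 : (M * A₀ i)ᴴ * effect H (β₁ i) * (M * A₀ i) =
          (A₀ i)ᴴ * (M * effect H (β₁ i) * M) * A₀ i := by
        rw [conjTranspose_mul, hMp.1.eq]
        simp only [Matrix.mul_assoc]
      have e3 : ((1 / 2 : ℂ) * (1 + sign (β₁ i) * ((A₀ i)ᴴ * H * A₀ i).trace)).re =
          1 / 2 + 1 / 2 * (sign (β₁ i) * ((A₀ i)ᴴ * H * A₀ i).trace).re := by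
        rw [show (1 / 2 : ℂ) = ((1 / 2 : ℝ) : ℂ) by push_cast; rfl, Complex.re_ofReal_mul,
          Complex.add_re, Complex.one_re]
        ring
      rw [e1, e2, e3] at key
      linarith
    have hsum := Finset.sum_le_sum gentle
    rw [average, le_inv_mul_iff₀ hcard] at h
    rw [Finset.sum_sub_distrib, Finset.sum_add_distrib, ← Finset.mul_sum, Finset.sum_const,
      Finset.sum_const, Finset.card_univ, nsmul_eq_mul, nsmul_eq_mul] at hsum
    rw [le_inv_mul_iff₀ hcard]
    linarith

end Reading

/-! ### Kraus operators -/

section Kraus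

variable {X Y : Type*} [Fintype X] [Fintype Y]

/-- A completely positive map has a Kraus decomposition: the Choi matrix is positive semidefinite,
and the rows of a square root of it are, up to conjugation, the Kraus operators. -/
theorem Channel.exists_kraus [DecidableEq X] [DecidableEq Y] (F : Channel X Y) :
    ∃ K : Y × X → Matrix Y X ℂ, (∀ M, F.toLin M = ∑ j, K j * M * (K j)ᴴ) ∧
      ∑ j, (K j)ᴴ * K j = 1 := by
  have choi : (Matrix.of fun p q : Y × X =>
      F.toLin (Matrix.single p.2 q.2 1) p.1 q.1).PosSemidef := by
    let e := Fintype.equivFin X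
    -- the image of the unnormalised maximally entangled state
    have h := F.completelyPositive (Fintype.card X)
      (proj fun p : X × Fin (Fintype.card X) => if e p.1 = p.2 then 1 else 0)
      (posSemidef_vecMulVec_self_star _)
    convert h.submatrix (fun p : Y × X => (p.1, e p.2)) using 1
    ext p q
    simp only [of_apply, submatrix_apply, ampliate]
    refine congrFun (congrFun (congrArg F.toLin ?_) _) _
    ext x x'
    simp only [proj, vecMulVec_apply, Pi.star_apply, of_apply, single_apply,
      EmbeddingLike.apply_eq_iff_eq]
    by_cases h1 : x = p.2 <;> by_cases h2 : x' = q.2 <;> simp [h1, h2, eq_comm]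
  obtain ⟨g, hg⟩ := exists_eq_conjTranspose_mul_self choi
  have hF : ∀ M, F.toLin M = ∑ j, (Matrix.of fun y x => star (g j (y, x))) * M *
      (Matrix.of fun y x => star (g j (y, x)))ᴴ := by
    intro M
    ext y y'
    have hM : M = ∑ x, ∑ x', M x x' • Matrix.single x x' (1 : ℂ) := by
      conv_lhs => rw [matrix_eq_sum_single M]
      simp
    have hC : ∀ x x', F.toLin (Matrix.single x x' 1) y y' =
        ∑ j, star (g j (y, x)) * g j (y', x') := by
      intro x x'
      have := congrFun (congrFun hg (y, x)) (y', x')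
      simpa only [of_apply, Matrix.mul_apply, conjTranspose_apply] using this
    conv_lhs => rw [hM]
    simp only [map_sum, map_smul, Matrix.sum_apply, Matrix.smul_apply, hC, smul_eq_mul,
      Matrix.mul_apply, of_apply, conjTranspose_apply, star_star, Finset.mul_sum, Finset.sum_mul]
    rw [Finset.sum_comm]
    rw [Finset.sum_congr rfl fun x' _ => Finset.sum_comm, Finset.sum_comm]
    refine Finset.sum_congr rfl fun j _ => Finset.sum_congr rfl fun x' _ =>
      Finset.sum_congr rfl fun x _ => ?_
    ring
  refine ⟨_, hF, ?_⟩
  ext x x'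
  have h := F.tracePreserving (Matrix.single x' x 1)
  rw [hF, trace_sum] at h
  have e : ∀ K : Matrix Y X ℂ, (K * Matrix.single x' x (1 : ℂ) * Kᴴ).trace =
      (Kᴴ * K) x x' := fun K => by
    rw [trace_mul_cycle, trace_mul_comm, trace_single_mul]
    simp
  rw [Finset.sum_congr rfl fun j _ => e _, ← Matrix.sum_apply] at h
  rw [h, one_apply]
  by_cases hx : x = x'
  · subst hx
    simp
  · rw [if_neg hx, trace_single_eq_of_ne _ _ _ (Ne.symm hx)]

theorem Channel.posSemidef_apply [DecidableEq X] [DecidableEq Y] (F : Channel X Y)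
    {ρ : Matrix X X ℂ} (hρ : ρ.PosSemidef) : (F.apply ρ).PosSemidef := by
  obtain ⟨K, hK, -⟩ := F.exists_kraus
  rw [Channel.apply, hK]
  exact posSemidef_sum _ fun j _ => hρ.mul_mul_conjTranspose_same _

/-- Measuring the output of a channel is a measurement of its input. -/
theorem Channel.exists_pullback_measurement [DecidableEq X] [DecidableEq Y] (F : Channel X Y)
    {P : ZMod 2 → Matrix Y Y ℂ} (hP : ∀ t, (P t).PosSemidef) (hP' : P 0 + P 1 = 1) :
    ∃ M : ZMod 2 → Matrix X X ℂ, (∀ t, (M t).PosSemidef) ∧ M 0 + M 1 = 1 ∧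
      ∀ t ρ, (M t * ρ).trace = (P t * F.toLin ρ).trace := by
  obtain ⟨K, hK, hK'⟩ := F.exists_kraus
  refine ⟨fun t => ∑ j, (K j)ᴴ * P t * K j,
    fun t => posSemidef_sum _ fun j _ => (hP t).conjTranspose_mul_mul_same _, ?_, fun t ρ => ?_⟩
  · simp only [← Finset.sum_add_distrib, ← Matrix.add_mul, ← Matrix.mul_add, hP', Matrix.mul_one,
      hK']
  · rw [hK, Matrix.sum_mul, Matrix.mul_sum, trace_sum, trace_sum]
    refine Finset.sum_congr rfl fun j _ => ?_
    rw [show (K j)ᴴ * P t * K j * ρ = (K j)ᴴ * (P t * K j * ρ) by simp only [Matrix.mul_assoc],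
      trace_mul_comm]
    simp only [Matrix.mul_assoc]

/-- The vectors `(K j ⊗ 1) ψ` for `ψ` the vector with coefficient matrix `Ψ`, as the columns of a
matrix. -/
noncomputable def krausVectors {J R : Type*} (K : J → Matrix Y X ℂ) (Ψ : Matrix X R ℂ) :
    Matrix (Y × R) J ℂ :=
  Matrix.of fun p j => (K j * Ψ) p.1 p.2

theorem Channel.applyRef_proj_eq {J R : Type*} [Fintype J] {F : Channel X Y}
    {K : J → Matrix Y X ℂ} (hK : ∀ M, F.toLin M = ∑ j, K j * M * (K j)ᴴ) (Ψ : Matrix X R ℂ) :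
    F.applyRef (proj fun p : X × R => Ψ p.1 p.2) = krausVectors K Ψ * (krausVectors K Ψ)ᴴ := by
  ext p q
  simp only [Channel.applyRef, ampliate, of_apply, hK, Matrix.sum_apply, Matrix.mul_apply,
    conjTranspose_apply, krausVectors, proj, vecMulVec_apply, Pi.star_apply, star_sum, star_mul',
    Finset.mul_sum, Finset.sum_mul]
  refine Finset.sum_congr rfl fun j _ => Finset.sum_congr rfl fun x _ =>
    Finset.sum_congr rfl fun x' _ => ?_
  ring

theorem trace_conjTranspose_krausVectors_mul {J R : Type*} [Fintype J] [Fintype R]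
    (K : J → Matrix Y X ℂ) (Ψ : Matrix X R ℂ) :
    ((krausVectors K Ψ)ᴴ * krausVectors K Ψ).trace = ((∑ j, (K j)ᴴ * K j) * (Ψ * Ψᴴ)).trace := by
  rw [Matrix.sum_mul, trace_sum, trace]
  refine Finset.sum_congr rfl fun j _ => ?_
  rw [show (K j)ᴴ * K j * (Ψ * Ψᴴ) = (K j)ᴴ * K j * Ψ * Ψᴴ by simp only [Matrix.mul_assoc],
    trace_mul_comm, show Ψᴴ * ((K j)ᴴ * K j * Ψ) = (K j * Ψ)ᴴ * (K j * Ψ) by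
      rw [conjTranspose_mul]; simp only [Matrix.mul_assoc]]
  rw [trace]
  simp only [diag]
  rw [Matrix.mul_apply, Fintype.sum_prod_type, Finset.sum_comm]
  simp only [Matrix.mul_apply (M := (K j * Ψ)ᴴ), conjTranspose_apply, krausVectors, of_apply]

end Kraus

/-! ### The reduced state of the server -/

section Privacy

variable {X Y R I J : Type*} [Fintype X] [DecidableEq X] [Fintype Y] [Fintype R]
  [Fintype I] [DecidableEq I] [Fintype J] [DecidableEq J]

/-- The reduced state on `I × J` of a superposition of channel outputs depends only on the reduced
state of the input, through a channel: an observable of the former is one of the latter. -/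
theorem re_trace_superposition_sub_le [Nonempty I] [DecidableEq Y] {K : I → J → Matrix Y X ℂ}
    (hK : ∀ i, ∑ j, (K i j)ᴴ * K i j = 1) (Ψ₀ Ψ₁ : Matrix X R ℂ)
    {Q : Matrix (I × J) (I × J) ℂ} (hQ : IsObservable Q) :
    (Q * ((superposition fun i => krausVectors (K i) Ψ₀)ᴴ *
        superposition (fun i => krausVectors (K i) Ψ₀) -
      (superposition fun i => krausVectors (K i) Ψ₁)ᴴ *
        superposition fun i => krausVectors (K i) Ψ₁)).trace.re ≤
      2 * traceDist (Ψ₀ * Ψ₀ᴴ) (Ψ₁ * Ψ₁ᴴ) := by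
  -- the adjoint of that channel, composed with transposition: positive and unital
  let G : Matrix (I × J) (I × J) ℂ → Matrix X X ℂ := fun P =>
    (Fintype.card I : ℂ)⁻¹ • ∑ b, ∑ b', P b b' • ((K b'.1 b'.2)ᴴ * K b.1 b.2)
  have hc : (((√(Fintype.card I))⁻¹ : ℝ) : ℂ) * (((√(Fintype.card I))⁻¹ : ℝ) : ℂ) =
      (Fintype.card I : ℂ)⁻¹ := by
    rw [← Complex.ofReal_mul, ← mul_inv, Real.mul_self_sqrt (Nat.cast_nonneg _)]
    simp
  have hcard : (Fintype.card I : ℂ) ≠ 0 := Nat.cast_ne_zero.2 Fintype.card_ne_zero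
  have hG1 : G 1 = 1 := by
    simp only [G, one_apply, ite_smul, one_smul, zero_smul, Finset.sum_ite_eq, Finset.mem_univ,
      if_true]
    rw [Fintype.sum_prod_type]
    simp only [hK, Finset.sum_const, Finset.card_univ]
    rw [← Nat.cast_smul_eq_nsmul ℂ, smul_smul, inv_mul_cancel₀ hcard, one_smul]
  have hGadd : ∀ P P', G (P + P') = G P + G P' := fun P P' => by
    simp only [G, Matrix.add_apply, add_smul, Finset.sum_add_distrib, smul_add]
  have hGneg : ∀ P, G (-P) = - G P := fun P => by
    simp only [G, Matrix.neg_apply, neg_smul, Finset.sum_neg_distrib, smul_neg]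
  have hGpos : ∀ P : Matrix (I × J) (I × J) ℂ, P.PosSemidef → (G P).PosSemidef := fun P hP => by
    obtain ⟨g, rfl⟩ := exists_eq_conjTranspose_mul_self hP
    refine PosSemidef.smul ?_ (by positivity)
    have e : ∑ b, ∑ b', (gᴴ * g) b b' • ((K b'.1 b'.2)ᴴ * K b.1 b.2) =
        ∑ c, (∑ b, star (g c b) • K b.1 b.2)ᴴ * (∑ b, star (g c b) • K b.1 b.2) := by
      simp only [Matrix.mul_apply (M := gᴴ), conjTranspose_apply, conjTranspose_sum,
        conjTranspose_smul, star_star, Matrix.sum_mul, Matrix.mul_sum, Finset.sum_smul,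
        Matrix.smul_mul, Matrix.mul_smul, Finset.smul_sum, smul_smul]
      rw [Finset.sum_congr rfl fun b _ => Finset.sum_comm, Finset.sum_comm]
    rw [e]
    exact posSemidef_sum _ fun c _ => posSemidef_conjTranspose_mul_self _
  have hGo : IsObservable (G Q) := by
    constructor
    · rw [sub_eq_add_neg, ← hGneg, ← hG1, ← hGadd, ← sub_eq_add_neg]
      exact hGpos _ hQ.1
    · rw [← hG1, ← hGadd]
      exact hGpos _ hQ.2
  have hT : ∀ Ψ : Matrix X R ℂ, (Q * ((superposition fun i => krausVectors (K i) Ψ)ᴴ *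
      superposition fun i => krausVectors (K i) Ψ)).trace = (G Q * (Ψ * Ψᴴ)).trace := fun Ψ => by
    simp only [G, Matrix.smul_mul, Matrix.sum_mul, trace_smul, trace_sum]
    rw [trace, Finset.smul_sum]
    refine Finset.sum_congr rfl fun b _ => ?_
    rw [diag_apply, Matrix.mul_apply, Finset.smul_sum]
    refine Finset.sum_congr rfl fun b' _ => ?_
    rw [show (K b'.1 b'.2)ᴴ * K b.1 b.2 * (Ψ * Ψᴴ) = (K b'.1 b'.2)ᴴ * K b.1 b.2 * Ψ * Ψᴴ by
      simp only [Matrix.mul_assoc], trace_mul_comm,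
      show Ψᴴ * ((K b'.1 b'.2)ᴴ * K b.1 b.2 * Ψ) = (K b'.1 b'.2 * Ψ)ᴴ * (K b.1 b.2 * Ψ) by
      rw [conjTranspose_mul]; simp only [Matrix.mul_assoc]]
    rw [trace, Matrix.mul_apply, Fintype.sum_prod_type, Finset.sum_comm]
    simp only [diag, Matrix.mul_apply (M := (K b'.1 b'.2 * Ψ)ᴴ), conjTranspose_apply, krausVectors,
      superposition, of_apply, smul_eq_mul, Finset.mul_sum, star_mul', RCLike.star_def,
      Complex.conj_ofReal, ← hc]
    refine Finset.sum_congr rfl fun r _ => Finset.sum_congr rfl fun o _ => ?_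
    ring
  rw [Matrix.mul_sub, trace_sub, hT, hT, ← trace_sub, ← Matrix.mul_sub]
  have := re_trace_mul_le_traceNorm (A := Ψ₀ * Ψ₀ᴴ - Ψ₁ * Ψ₁ᴴ) hGo
  unfold traceDist
  linarith

end Privacy

/-! ### Purified encryptions -/

section Purification

variable {X Y R K J : Type*} [Fintype X] [Fintype Y] [Fintype R] [Fintype K] [Fintype J]

/-- The coefficient matrix of the purification `∑ₖ √pₖ |k⟩ |φₖ⟩` of the mixture of the operators
`Bₖ Bₖ†` with weights `pₖ`, where `φₖ` has coefficient matrix `Bₖ`. The purifying register `R` holds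
the index `k`; it is identified with `K × X` along `e`. -/
noncomputable def mixturePurification (e : R ≃ K × X) (p : K → ℝ) (b : K → Matrix X X ℂ) :
    Matrix X R ℂ :=
  Matrix.of fun x r => ((√(p (e r).1) : ℝ) : ℂ) * b (e r).1 x (e r).2

theorem mixturePurification_mul_conjTranspose (e : R ≃ K × X) {p : K → ℝ} (hp : ∀ k, 0 ≤ p k)
    (b : K → Matrix X X ℂ) :
    mixturePurification e p b * (mixturePurification e p b)ᴴ =
      ∑ k, (p k : ℂ) • (b k * (b k)ᴴ) := by
  ext x x'
  rw [Matrix.mul_apply, ← e.symm.sum_comp, Fintype.sum_prod_type, Matrix.sum_apply]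
  refine Finset.sum_congr rfl fun k _ => ?_
  rw [Matrix.smul_apply, Matrix.mul_apply, Finset.smul_sum]
  refine Finset.sum_congr rfl fun x'' _ => ?_
  have h : ((√(p k) : ℝ) : ℂ) * ((√(p k) : ℝ) : ℂ) = (p k : ℂ) := by
    rw [← Complex.ofReal_mul, Real.mul_self_sqrt (hp k)]
  simp only [mixturePurification, conjTranspose_apply, of_apply, Equiv.apply_symm_apply, star_mul',
    RCLike.star_def, Complex.conj_ofReal, smul_eq_mul, ← h]
  ring

/-- The holder of the purifying register may read the index `k` from it and then measure `M k`: in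
the purified state this is as good as in the mixture. -/
theorem trace_blockDiagonal_krausVectors [DecidableEq R] (e : R ≃ K × X) {p : K → ℝ}
    (hp : ∀ k, 0 ≤ p k) (b : K → Matrix X X ℂ) (L : J → Matrix Y X ℂ) (M : K → Matrix Y Y ℂ) :
    ((krausVectors L (mixturePurification e p b))ᴴ * blockDiagonal (fun r => M (e r).1) *
        krausVectors L (mixturePurification e p b)).trace =
      ∑ k, (p k : ℂ) * (M k * ∑ j, L j * (b k * (b k)ᴴ) * (L j)ᴴ).trace := by
  have h1 : ∀ k, (M k * ∑ j, L j * (b k * (b k)ᴴ) * (L j)ᴴ).trace =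
      ∑ j, ∑ x, ((L j * b k)ᴴ * (M k * (L j * b k))) x x := fun k => by
    rw [Matrix.mul_sum, trace_sum]
    refine Finset.sum_congr rfl fun j _ => ?_
    rw [show M k * (L j * (b k * (b k)ᴴ) * (L j)ᴴ) = (M k * (L j * b k)) * ((L j * b k)ᴴ) by
      rw [conjTranspose_mul]; simp only [Matrix.mul_assoc], trace_mul_comm]
    rfl
  have h2 : ∀ j k x y, (L j * mixturePurification e p b) y (e.symm (k, x)) =
      ((√(p k) : ℝ) : ℂ) * (L j * b k) y x := fun j k x y => by
    simp only [Matrix.mul_apply, mixturePurification, of_apply, Equiv.apply_symm_apply,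
      Finset.mul_sum]
    refine Finset.sum_congr rfl fun x' _ => ?_
    ring
  rw [Finset.sum_congr rfl fun k _ => congrArg _ (h1 k)]
  simp only [Finset.mul_sum]
  rw [Matrix.mul_assoc, trace, Finset.sum_comm]
  refine Finset.sum_congr rfl fun j _ => ?_
  rw [diag_apply, Matrix.mul_apply, Fintype.sum_prod_type, Finset.sum_comm, ← e.symm.sum_comp,
    Fintype.sum_prod_type]
  refine Finset.sum_congr rfl fun k _ => Finset.sum_congr rfl fun x _ => ?_
  rw [Matrix.mul_apply, Finset.mul_sum]
  refine Finset.sum_congr rfl fun y _ => ?_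
  have h : ((√(p k) : ℝ) : ℂ) * ((√(p k) : ℝ) : ℂ) = (p k : ℂ) := by
    rw [← Complex.ofReal_mul, Real.mul_self_sqrt (hp k)]
  have h3 : (blockDiagonal (fun r => M (e r).1) * krausVectors L (mixturePurification e p b))
      (y, e.symm (k, x)) j = ((√(p k) : ℝ) : ℂ) * (M k * (L j * b k)) y x := by
    rw [Matrix.mul_apply, Fintype.sum_prod_type, Matrix.mul_apply, Finset.mul_sum]
    refine Finset.sum_congr rfl fun y' _ => ?_
    simp only [blockDiagonal_apply, ite_mul, zero_mul, Finset.sum_ite_eq, Finset.mem_univ, if_true,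
      Equiv.apply_symm_apply, krausVectors, of_apply, h2]
    ring
  rw [h3]
  simp only [conjTranspose_apply, krausVectors, of_apply, h2, star_mul', RCLike.star_def,
    Complex.conj_ofReal, ← h]
  ring

theorem posSemidef_blockDiagonal [DecidableEq Y] [DecidableEq R] {M : R → Matrix Y Y ℂ}
    (hM : ∀ r, (M r).PosSemidef) : (blockDiagonal M).PosSemidef := by
  choose g hg using fun r => exists_eq_conjTranspose_mul_self (hM r)
  have : blockDiagonal M = (blockDiagonal g)ᴴ * blockDiagonal g := by
    rw [blockDiagonal_conjTranspose, ← blockDiagonal_mul]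
    exact congrArg _ (funext hg)
  rw [this]
  exact posSemidef_conjTranspose_mul_self _

theorem isPureState_iff_trace (Ψ : Matrix X R ℂ) :
    IsPureState (fun p : X × R => Ψ p.1 p.2) ↔ (Ψ * Ψᴴ).trace = 1 := by
  have : (Ψ * Ψᴴ).trace = ((∑ p : X × R, ‖Ψ p.1 p.2‖ ^ 2 : ℝ) : ℂ) := by
    rw [Fintype.sum_prod_type, trace]
    simp only [diag_apply, Matrix.mul_apply, conjTranspose_apply, RCLike.star_def,
      Complex.mul_conj', Complex.ofReal_sum, Complex.ofReal_pow]
  rw [this, IsPureState]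
  norm_cast

end Purification

/-! ### Reading an honest result -/

section Scheme

/-- The projective measurement of a bit `d` of the computational basis. -/
noncomputable def bitProjection {O : Type*} [DecidableEq O] (d : O → ZMod 2) (t : ZMod 2) :
    Matrix O O ℂ :=
  diagonal fun z => if d z = t then 1 else 0

theorem posSemidef_bitProjection {O : Type*} [DecidableEq O] (d : O → ZMod 2) (t : ZMod 2) :
    (bitProjection d t).PosSemidef := by
  refine PosSemidef.diagonal fun z => ?_
  by_cases h : d z = t <;> simp [h]

theorem bitProjection_zero_add_one {O : Type*} [DecidableEq O] (d : O → ZMod 2) :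
    bitProjection d 0 + bitProjection d 1 = 1 := by
  rw [bitProjection, bitProjection, diagonal_add, ← diagonal_one]
  congr 1
  funext z
  rcases bit_cases (d z) with h | h <;> simp [h]

variable {A O Ahat Ohat : Type*} [Fintype A] [DecidableEq A] [Fintype O] [DecidableEq O]
  [Fintype Ahat] [Fintype Ohat]

theorem isDensity_single (a : A) : IsDensity (Matrix.single a a (1 : ℂ)) := by
  refine ⟨?_, by simp⟩
  have := posSemidef_vecMulVec_self_star (Pi.single a (1 : ℂ))
  convert this using 1
  ext x y
  by_cases h1 : x = a <;> by_cases h2 : y = a <;>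
    simp [vecMulVec_apply, h1, h2, eq_comm (a := a)]

/-- In a correct scheme, if the channel maps the basis state `a` to states whose bit `d` has the
value `t`, then the decrypted result has this bit up to an error `ε`. -/
theorem Scheme.IsCorrect.le_re_trace {Q : Scheme A O Ahat Ohat} {ε : ℝ} (hQ : Q.IsCorrect ε)
    (F : Q.channels) {a : A} {d : O → ZMod 2} {t : ZMod 2}
    (h : ∀ z, d z ≠ t → F.1.toLin (Matrix.single a a 1) z z = 0) (k : Fin Q.keyLength → Bool) :
    1 - ε ≤ (bitProjection d t * (Q.dec k).toLin ((Q.eval F).toLin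
      ((Q.enc k).toLin (Matrix.single a a 1)))).trace.re := by
  let ψ : A × Fin 1 → ℂ := fun p => if p.1 = a then 1 else 0
  have hψ : IsPureState ψ := by
    simp only [IsPureState, ψ, Fintype.sum_prod_type]
    simp [apply_ite]
  have hc := hQ F 1 ψ hψ k
  set ρ := (Q.dec k).applyRef ((Q.eval F).applyRef ((Q.enc k).applyRef (proj ψ))) with hρ
  set σ := F.1.applyRef (proj ψ) with hσ
  have hs : ∀ r r' : Fin 1, (Matrix.of fun x x' => proj ψ (x, r) (x', r')) =
      Matrix.single a a (1 : ℂ) := fun r r' => by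
    ext x x'
    by_cases h1 : x = a <;> by_cases h2 : x' = a <;>
      simp [proj, ψ, vecMulVec_apply, h1, h2, eq_comm (a := a)]
  have eσ : ∀ z z' r r', σ (z, r) (z', r') = F.1.toLin (Matrix.single a a 1) z z' := by
    intro z z' r r'
    rw [← hs r r']
    rfl
  have eρ : ∀ z z' r r', ρ (z, r) (z', r') = (Q.dec k).toLin ((Q.eval F).toLin
      ((Q.enc k).toLin (Matrix.single a a 1))) z z' := by
    intro z z' r r'
    rw [← hs r r']
    rfl
  have one_trace : (Matrix.single a a (1 : ℂ)).trace = 1 := by simp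
  have tr_eq : ∀ (M : Matrix (O × Fin 1) (O × Fin 1) ℂ) (M' : Matrix O O ℂ),
      (∀ z z' r r', M (z, r) (z', r') = M' z z') → M.trace = M'.trace := fun M M' h => by
    simp [trace, Fintype.sum_prod_type, h]
  have trρ : ρ.trace = 1 := by
    rw [tr_eq _ _ eρ, (Q.dec k).tracePreserving, (Q.eval F).tracePreserving,
      (Q.enc k).tracePreserving, one_trace]
  have trσ : σ.trace = 1 := by rw [tr_eq _ _ eσ, F.1.tracePreserving, one_trace]
  let d' : O × Fin 1 → ZMod 2 := fun p => d p.1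
  have htt : bitProjection d' t + bitProjection d' (t + 1) = 1 := by
    rcases bit_cases t with rfl | rfl
    · rw [zero_add]
      exact bitProjection_zero_add_one d'
    · rw [add_comm, show (1 + 1 : ZMod 2) = 0 from rfl]
      exact bitProjection_zero_add_one d'
  have key := re_trace_mul_sub_le_traceDist (posSemidef_bitProjection d' (t + 1))
    (by rw [← htt, add_sub_cancel_right]; exact posSemidef_bitProjection d' t)
    (trρ.trans trσ.symm)
  have hzero : (bitProjection d' (t + 1) * σ).trace = 0 := by
    rw [trace]
    refine Finset.sum_eq_zero fun p _ => ?_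
    rw [diag_apply, bitProjection, diagonal_mul]
    by_cases hp : d' p = t + 1
    · have hne : d p.1 ≠ t := by
        rw [show d p.1 = t + 1 from hp]
        simp
      rw [show σ p p = _ from eσ p.1 p.1 p.2 p.2, h _ hne, mul_zero]
    · rw [if_neg hp, zero_mul]
  have hcompl : (bitProjection d' (t + 1) * ρ).trace = 1 - (bitProjection d' t * ρ).trace := by
    rw [show bitProjection d' (t + 1) = 1 - bitProjection d' t by rw [← htt]; abel,
      Matrix.sub_mul, trace_sub, Matrix.one_mul, trρ]
  have hfin : (bitProjection d' t * ρ).trace = (bitProjection d t * (Q.dec k).toLin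
      ((Q.eval F).toLin ((Q.enc k).toLin (Matrix.single a a 1)))).trace := by
    refine tr_eq _ _ fun z z' r r' => ?_
    rw [bitProjection, bitProjection, diagonal_mul, diagonal_mul, eρ]
  rw [hzero, hcompl, hfin, Complex.sub_re, Complex.one_re, Complex.zero_re] at key
  linarith

end Scheme

/-! ### The attack on a scheme and the bound -/

section Bound

theorem sum_keyGen_toReal {A O Ahat Ohat : Type*} [Fintype A] [Fintype O]
    [Fintype Ahat] [Fintype Ohat] (Q : Scheme A O Ahat Ohat) : ∑ k, (Q.keyGen k).toReal = 1 := by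
  have h := Q.keyGen.tsum_coe
  rw [tsum_fintype] at h
  rw [← ENNReal.toReal_sum fun k _ => Q.keyGen.apply_ne_top k, h, ENNReal.toReal_one]

theorem trace_proj {X : Type*} [Fintype X] {ψ : X → ℂ} (hψ : IsPureState ψ) :
    (proj ψ).trace = 1 := by
  rw [IsPureState] at hψ
  rw [trace]
  simp only [diag_apply, proj, vecMulVec_apply, Pi.star_apply, RCLike.star_def, Complex.mul_conj']
  exact_mod_cast hψ

theorem Channel.trace_applyRef {X Y R : Type*} [Fintype X] [Fintype Y] [Fintype R]
    (F : Channel X Y) (ρ : Matrix (X × R) (X × R) ℂ) : (F.applyRef ρ).trace = ρ.trace := by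
  rw [trace, trace, Fintype.sum_prod_type_right, Fintype.sum_prod_type_right]
  exact Finset.sum_congr rfl fun r _ =>
    F.tracePreserving (Matrix.of fun x x' => ρ (x, r) (x', r))

variable {A O Ahat Ohat : Type*} [Fintype A] [DecidableEq A] [Fintype O] [DecidableEq O]
  [Fintype Ahat] [DecidableEq Ahat] [Fintype Ohat] [DecidableEq Ohat]

/-- Suppose that the channels `F i` map the basis state `a₀` to states with the bit `β₀ i`, and `a₁`
to states with the bit `β₁ i`. A client who purifies the key and encrypts `a₀` can find out both
bits of `i` with one measurement of the evaluated message and the purifying register. -/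
theorem Scheme.exists_attack {Q : Scheme A O Ahat Ohat} {ε εd : ℝ} (hcorr : Q.IsCorrect ε)
    (hpriv : Q.IsDataPrivate εd) {I : Type*} [Fintype I] [DecidableEq I] [Nonempty I]
    (F : I → Q.channels) {β₀ β₁ : I → ZMod 2} {a₀ a₁ : A} {d : O → ZMod 2}
    (h₀ : ∀ i z, d z ≠ β₀ i → (F i).1.toLin (Matrix.single a₀ a₀ 1) z z = 0)
    (h₁ : ∀ i z, d z ≠ β₁ i → (F i).1.toLin (Matrix.single a₁ a₁ 1) z z = 0) :
    ∃ (m : ℕ) (ψ : Ahat × Fin m → ℂ), IsPureState ψ ∧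
      ∃ E : ZMod 2 → ZMod 2 → Matrix (Ohat × Fin m) (Ohat × Fin m) ℂ,
        (∀ s t, (E s t).PosSemidef) ∧ (1 - ∑ s, ∑ t, E s t).PosSemidef ∧
        1 - εd - 4 * √ε ≤ (Fintype.card I : ℝ)⁻¹ *
          ∑ i, (E (β₀ i) (β₁ i) * (Q.eval (F i)).applyRef (proj ψ)).trace.re := by
  let p : (Fin Q.keyLength → Bool) → ℝ := fun k => (Q.keyGen k).toReal
  have hp : ∀ k, 0 ≤ p k := fun k => ENNReal.toReal_nonneg
  have hp1 : ∑ k, p k = 1 := sum_keyGen_toReal Q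
  have hb : ∀ (a : A) (k : Fin Q.keyLength → Bool), ∃ b : Matrix Ahat Ahat ℂ,
      (Q.enc k).toLin (Matrix.single a a 1) = b * bᴴ := fun a k => by
    obtain ⟨g, hg⟩ := exists_eq_conjTranspose_mul_self
      ((Q.enc k).posSemidef_apply (isDensity_single a).1)
    exact ⟨gᴴ, by rw [conjTranspose_conjTranspose]; exact hg⟩
  choose b hb using hb
  let e := (Fintype.equivFin ((Fin Q.keyLength → Bool) × Ahat)).symm
  let Ψ : A → Matrix Ahat _ ℂ := fun a => mixturePurification e p (b a)
  have hΨ : ∀ a, Ψ a * (Ψ a)ᴴ = Q.avgEnc (Matrix.single a a 1) := fun a => by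
    rw [mixturePurification_mul_conjTranspose e hp]
    simp only [← hb]
    rfl
  have hΨ1 : ∀ a, (Ψ a * (Ψ a)ᴴ).trace = 1 := fun a => by
    have : ∀ k, ((Q.enc k).toLin (Matrix.single a a (1 : ℂ))).trace = 1 := fun k => by
      rw [(Q.enc k).tracePreserving]
      simp
    rw [mixturePurification_mul_conjTranspose e hp, trace_sum]
    simp only [trace_smul, ← hb, this, smul_eq_mul, mul_one]
    rw [← Complex.ofReal_sum, hp1, Complex.ofReal_one]
  choose K hK hK1 using fun i => (Q.eval (F i)).exists_kraus
  have htr : ∀ a i, ((krausVectors (K i) (Ψ a))ᴴ * krausVectors (K i) (Ψ a)).trace = 1 :=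
    fun a i => by
      rw [trace_conjTranspose_krausVectors_mul, hK1, Matrix.one_mul, hΨ1]
  choose M hM hM1 hMtr using fun k => (Q.dec k).exists_pullback_measurement
    (posSemidef_bitProjection d) (bitProjection_zero_add_one d)
  -- the honest measurement: read the key, decrypt, and measure the bit `d`
  let N : ZMod 2 → Matrix _ _ ℂ := fun t => blockDiagonal fun r => M (e r).1 t
  have hN : ∀ t, (N t).PosSemidef := fun t => posSemidef_blockDiagonal fun r => hM _ t
  have hN1 : N 0 + N 1 = 1 := by
    rw [← blockDiagonal_add, ← blockDiagonal_one]
    exact congrArg _ (funext fun r => hM1 _)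
  have hread : ∀ {a : A} {β : I → ZMod 2},
      (∀ i z, d z ≠ β i → (F i).1.toLin (Matrix.single a a 1) z z = 0) → ∀ i, 1 - ε ≤
        ((krausVectors (K i) (Ψ a))ᴴ * N (β i) * krausVectors (K i) (Ψ a)).trace.re := by
    intro a β h i
    rw [trace_blockDiagonal_krausVectors e hp (b a) (K i) fun k => M k (β i)]
    simp only [← hb, ← hK, hMtr]
    rw [Complex.re_sum]
    calc 1 - ε = ∑ k, p k * (1 - ε) := by rw [← Finset.sum_mul, hp1, one_mul]
      _ ≤ _ := Finset.sum_le_sum fun k _ => by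
        rw [Complex.re_ofReal_mul]
        exact mul_le_mul_of_nonneg_left (hcorr.le_re_trace (F i) (h i) k) (hp k)
  obtain ⟨E, hE, hE1, hbound⟩ := exists_joint_measurement (htr a₀) (htr a₁) hN hN hN1 hN1
    (hread h₀) (hread h₁) (δ := εd) fun P hP => by
      refine (re_trace_superposition_sub_le hK1 (Ψ a₀) (Ψ a₁) hP).trans ?_
      rw [hΨ, hΨ]
      have := hpriv _ _ (isDensity_single a₀) (isDensity_single a₁)
      linarith
  refine ⟨_, fun q => Ψ a₀ q.1 q.2, (isPureState_iff_trace _).2 (hΨ1 a₀), E, hE, hE1, ?_⟩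
  refine hbound.trans_eq (congrArg _ (Finset.sum_congr rfl fun i _ => ?_))
  rw [Channel.applyRef_proj_eq (hK i), trace_mul_cycle, trace_mul_comm]

/-- If a family of states has the form `T₀ x₀ + T₁ x₁` with unnormalised states `T₀ x₀` and
`T₁ x₁`, then no measurement identifies both bits with an average probability above one half: each
summand reveals only one of the bits. -/
theorem sum_re_trace_le_two_mul {Y : Type*} [Fintype Y] [DecidableEq Y]
    {E T : ZMod 2 → ZMod 2 → Matrix Y Y ℂ} (hE : ∀ s t, (E s t).PosSemidef)
    (hE1 : (1 - ∑ s, ∑ t, E s t).PosSemidef) (hT : ∀ s t, (T s t).PosSemidef) {c : ℝ}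
    (hc : ∀ x₀ x₁, (T 0 x₀ + T 1 x₁).trace.re = c) :
    ∑ x₀, ∑ x₁, (E x₀ x₁ * (T 0 x₀ + T 1 x₁)).trace.re ≤ 2 * c := by
  have le : ∀ P : Matrix Y Y ℂ, (1 - P).PosSemidef → ∀ R : Matrix Y Y ℂ, R.PosSemidef →
      (P * R).trace.re ≤ R.trace.re := fun P hP R hR => by
    have := re_trace_mul_nonneg hP hR
    rw [Matrix.sub_mul, Matrix.one_mul, trace_sub, Complex.sub_re] at this
    linarith
  simp only [sum_bits] at hE1 ⊢
  have a0 := le (E 0 0 + E 0 1) (by convert hE1.add ((hE 1 0).add (hE 1 1)) using 1; abel) _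
    (hT 0 0)
  have a1 := le (E 1 0 + E 1 1) (by convert hE1.add ((hE 0 0).add (hE 0 1)) using 1; abel) _
    (hT 0 1)
  have b0 := le (E 0 0 + E 1 0) (by convert hE1.add ((hE 0 1).add (hE 1 1)) using 1; abel) _
    (hT 1 0)
  have b1 := le (E 0 1 + E 1 1) (by convert hE1.add ((hE 0 0).add (hE 1 0)) using 1; abel) _
    (hT 1 1)
  have c0 := hc 0 0
  have c1 := hc 1 1
  simp only [Matrix.mul_add, Matrix.add_mul, trace_add, Complex.add_re] at *
  linarith

/-- The bound for every scheme whose channels include an oblivious transfer. Here `T` indexes a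
randomisation of the channels. The hypothesis `hideal` says that, on average over `T`, the output of
the channels is a mixture of a part that depends on `x₀` only and a part that depends on `x₁`
only. -/
theorem Scheme.half_le_of_obliviousTransfer {Q : Scheme A O Ahat Ohat} {ε εd εc : ℝ}
    (hcorr : Q.IsCorrect ε) (hpriv : Q.IsDataPrivate εd) (hcirc : Q.IsCircuitPrivate εc)
    {T : Type*} [Fintype T] [DecidableEq T] [Nonempty T]
    (F : ZMod 2 → ZMod 2 → T → Q.channels) {a₀ a₁ : A} {d : O → ZMod 2}
    (h₀ : ∀ x₀ x₁ t z, d z ≠ x₀ → (F x₀ x₁ t).1.toLin (Matrix.single a₀ a₀ 1) z z = 0)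
    (h₁ : ∀ x₀ x₁ t z, d z ≠ x₁ → (F x₀ x₁ t).1.toLin (Matrix.single a₁ a₁ 1) z z = 0)
    (hideal : ∀ (m : ℕ) (ψ : A × Fin m → ℂ),
      ∃ G : ZMod 2 → ZMod 2 → Matrix (O × Fin m) (O × Fin m) ℂ, (∀ s y, (G s y).PosSemidef) ∧
        ∀ x₀ x₁, ∑ t, (F x₀ x₁ t).1.applyRef (proj ψ) = G 0 x₀ + G 1 x₁) :
    1 / 2 ≤ εc + εd + 4 * √ε := by
  obtain ⟨m, ψ, hψ, E, hE, hE1, hatt⟩ := Q.exists_attack hcorr hpriv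
    (fun i : ZMod 2 × ZMod 2 × T => F i.1 i.2.1 i.2.2) (β₀ := fun i => i.1) (β₁ := fun i => i.2.1)
    (fun i => h₀ _ _ _) (fun i => h₁ _ _ _)
  obtain ⟨m', ψ', hψ', N, hN⟩ := hcirc m ψ hψ
  obtain ⟨G, hG, hGsum⟩ := hideal m' ψ'
  have hcard : (0 : ℝ) < Fintype.card T := Nat.cast_pos.2 Fintype.card_pos
  have hEle : ∀ s t, (1 - E s t).PosSemidef := by
    intro s t
    have hsub : ∀ (f : ZMod 2 → Matrix (Ohat × Fin m) (Ohat × Fin m) ℂ) (u : ZMod 2),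
        (∀ v, (f v).PosSemidef) → (∑ v, f v - f u).PosSemidef := fun f u hf => by
      rw [← Finset.add_sum_erase _ f (Finset.mem_univ u), add_sub_cancel_left]
      exact posSemidef_sum _ fun v _ => hf v
    have e1 := hsub (fun t => E s t) t (hE s)
    have e2 := hsub (fun s => ∑ t, E s t) s fun s => posSemidef_sum _ fun t _ => hE s t
    convert hE1.add (e2.add e1) using 1
    abel
  have hstep : ∀ i : ZMod 2 × ZMod 2 × T,
      (E i.1 i.2.1 * (Q.eval (F i.1 i.2.1 i.2.2)).applyRef (proj ψ)).trace.re ≤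
        (E i.1 i.2.1 * N.apply ((F i.1 i.2.1 i.2.2).1.applyRef (proj ψ'))).trace.re + εc := by
    intro i
    have := re_trace_mul_sub_le_traceDist (hE i.1 i.2.1) (hEle i.1 i.2.1)
      (A := (Q.eval (F i.1 i.2.1 i.2.2)).applyRef (proj ψ))
      (B := N.apply ((F i.1 i.2.1 i.2.2).1.applyRef (proj ψ')))
      (by rw [Channel.trace_applyRef, Channel.apply, N.tracePreserving, Channel.trace_applyRef,
        trace_proj hψ, trace_proj hψ'])
    linarith [hN (F i.1 i.2.1 i.2.2)]
  have hNadd : ∀ x₀ x₁, N.apply (G 0 x₀) + N.apply (G 1 x₁) =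
      ∑ t, N.apply ((F x₀ x₁ t).1.applyRef (proj ψ')) := fun x₀ x₁ => by
    simp only [Channel.apply, ← map_add, ← map_sum, hGsum]
  have hbound := sum_re_trace_le_two_mul hE hE1 (T := fun s y => N.apply (G s y))
    (fun s y => N.posSemidef_apply (hG s y)) (c := Fintype.card T) fun x₀ x₁ => by
      rw [hNadd, trace_sum]
      simp only [Channel.apply, N.tracePreserving, Channel.trace_applyRef, trace_proj hψ']
      simp
  have hsum := Finset.sum_le_sum fun i (_ : i ∈ Finset.univ) => hstep i
  rw [Finset.sum_add_distrib, Finset.sum_const, nsmul_eq_mul, Finset.card_univ,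
    Fintype.sum_prod_type (f := fun i : ZMod 2 × ZMod 2 × T =>
      (E i.1 i.2.1 * N.apply ((F i.1 i.2.1 i.2.2).1.applyRef (proj ψ'))).trace.re)] at hsum
  simp only [Fintype.sum_prod_type, hNadd, Matrix.mul_sum, trace_sum, Complex.re_sum] at hsum hbound
  have hcardI : (Fintype.card (ZMod 2 × ZMod 2 × T) : ℝ) = 4 * Fintype.card T := by
    rw [Fintype.card_prod, Fintype.card_prod, ZMod.card]
    push_cast
    ring
  rw [hcardI] at hatt hsum
  rw [le_inv_mul_iff₀ (by positivity)] at hatt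
  simp only [Fintype.sum_prod_type] at hatt
  have : (4 * (Fintype.card T : ℝ)) * (1 - εd - 4 * √ε) ≤ (4 * Fintype.card T) * (1 / 2 + εc) := by
    linarith
  have := le_of_mul_le_mul_left this (by positivity)
  linarith

end Bound

/-! ### Monomial matrices -/

section Monomial

/-- The operator with rows `u ↦ χ u ⟨κ u|`: it permutes the computational basis, if `κ` is a
permutation, and multiplies by phases. -/
def monomial {X : Type*} [DecidableEq X] (κ : X → X) (χ : X → ℂ) : Matrix X X ℂ :=
  Matrix.of fun u v => if v = κ u then χ u else 0

variable {X : Type*} [Fintype X] [DecidableEq X]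

theorem monomial_mul (κ κ' : X → X) (χ χ' : X → ℂ) :
    monomial κ χ * monomial κ' χ' = monomial (κ' ∘ κ) (fun u => χ u * χ' (κ u)) := by
  ext u v
  rw [Matrix.mul_apply, Finset.sum_eq_single (κ u)]
  · simp [monomial]
  · intro w _ hw
    simp [monomial, hw]
  · simp

theorem unitaryChannel_toLin_apply {U : Matrix.unitaryGroup X ℂ} {κ : X → X} {χ : X → ℂ}
    (hU : (U : Matrix X X ℂ) = monomial κ χ) (ρ : Matrix X X ℂ) (u v : X) :
    (unitaryChannel U).toLin ρ u v = χ u * ρ (κ u) (κ v) * star (χ v) := by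
  change ((U : Matrix X X ℂ) * ρ * (U : Matrix X X ℂ)ᴴ) u v = _
  rw [hU]
  simp [monomial, Matrix.mul_apply, apply_ite]

end Monomial

/-! ### Pauli and Clifford unitaries -/

section Gates

variable {n : ℕ}

theorem bits_add_self (v : Qubits n) : v + v = 0 := by
  funext j
  exact CharTwo.add_self_eq_zero _

theorem sign_add (s t : ZMod 2) : sign (s + t) = sign s * sign t := by
  rcases bit_cases s with rfl | rfl <;> rcases bit_cases t with rfl | rfl <;>
    simp [show (1 + 1 : ZMod 2) = 0 from rfl]

theorem pauli_eq_monomial (a b : Qubits n) :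
    (pauli a b : Matrix (Qubits n) (Qubits n) ℂ) =
      monomial (fun u => u + a) (fun u => sign (b ⬝ᵥ (u + a))) := by
  ext u v
  have h : u = v + a ↔ v = u + a := by
    constructor <;> rintro rfl <;> rw [add_assoc, bits_add_self, add_zero]
  simp only [pauli, monomial, of_apply, h]
  split_ifs with hv
  · rw [hv]
    rfl
  · rfl

/-- The action of a `CNOT` gate on the computational basis. -/
def cnotMap (c t : Fin n) (v : Qubits n) : Qubits n := v + Pi.single t (v c)

theorem cnotMap_add (c t : Fin n) (u v : Qubits n) :
    cnotMap c t (u + v) = cnotMap c t u + cnotMap c t v := by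
  simp only [cnotMap, Pi.add_apply, Pi.single_add]
  abel

theorem cnotMap_cnotMap {c t : Fin n} (h : c ≠ t) (v : Qubits n) :
    cnotMap c t (cnotMap c t v) = v := by
  rw [cnotMap, cnotMap, Pi.add_apply, Pi.single_eq_of_ne h, add_zero, add_assoc, bits_add_self,
    add_zero]

theorem cnot_eq_monomial {c t : Fin n} (h : c ≠ t) :
    (cnot c t h : Matrix (Qubits n) (Qubits n) ℂ) = monomial (cnotMap c t) (fun _ => 1) := by
  ext u v
  have e : Function.update v t (v t + v c) = cnotMap c t v := by
    funext j
    by_cases hj : j = t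
    · subst hj
      simp [cnotMap]
    · simp [cnotMap, hj]
  have h' : u = cnotMap c t v ↔ v = cnotMap c t u := by
    constructor <;> rintro rfl <;> rw [cnotMap_cnotMap h]
  simp only [cnot, monomial, of_apply, e, h']

theorem isClifford_of_mul {U : Matrix.unitaryGroup (Qubits n) ℂ}
    (h : ∀ a b : Qubits n, ∃ (a' b' : Qubits n) (c : ℂ),
      (U : Matrix (Qubits n) (Qubits n) ℂ) * (pauli a b).1 = c • ((pauli a' b').1 * U.1)) :
    IsClifford U := by
  intro a b
  obtain ⟨a', b', c, e⟩ := h a b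
  refine ⟨a', b', c, ?_⟩
  have hU : U.1 * (U⁻¹ : Matrix.unitaryGroup (Qubits n) ℂ).1 = 1 := by
    have := congrArg Subtype.val (mul_inv_cancel U)
    exact this
  change U.1 * (pauli a b).1 * (U⁻¹ : Matrix.unitaryGroup (Qubits n) ℂ).1 = _
  rw [e, Matrix.smul_mul, Matrix.mul_assoc, hU, Matrix.mul_one]

theorem IsClifford.mul {U V : Matrix.unitaryGroup (Qubits n) ℂ} (hU : IsClifford U)
    (hV : IsClifford V) : IsClifford (U * V) := by
  intro a b
  obtain ⟨a', b', c, e⟩ := hV a b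
  obtain ⟨a'', b'', c', e'⟩ := hU a' b'
  refine ⟨a'', b'', c * c', ?_⟩
  rw [mul_smul, ← e', show U * V * pauli a b * (U * V)⁻¹ = U * (V * pauli a b * V⁻¹) * U⁻¹ by group]
  change U.1 * (V * pauli a b * V⁻¹ : Matrix.unitaryGroup (Qubits n) ℂ).1 * (U⁻¹).1 =
    c • (U.1 * (pauli a' b').1 * (U⁻¹).1)
  rw [e, Matrix.mul_smul, Matrix.smul_mul]

theorem isClifford_one : IsClifford (1 : Matrix.unitaryGroup (Qubits n) ℂ) := by
  intro a b
  exact ⟨a, b, 1, by simp⟩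

theorem isClifford_pauli (a b : Qubits n) : IsClifford (pauli a b) := by
  refine isClifford_of_mul fun a' b' => ⟨a', b', sign (b ⬝ᵥ a') * sign (b' ⬝ᵥ a), ?_⟩
  rw [pauli_eq_monomial, pauli_eq_monomial, monomial_mul, monomial_mul]
  ext u v
  have e : u + a + a' = u + a' + a := by abel
  simp only [monomial, of_apply, Function.comp_apply, Matrix.smul_apply, smul_eq_mul, mul_ite,
    mul_zero, e]
  congr 1
  simp only [dotProduct_add, sign_add]
  linear_combination (-(sign (b ⬝ᵥ u) * sign (b ⬝ᵥ a) * sign (b' ⬝ᵥ u) * sign (b' ⬝ᵥ a') *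
    sign (b' ⬝ᵥ a))) * sign_mul_self (b ⬝ᵥ a')

theorem isClifford_cnot {c t : Fin n} (h : c ≠ t) : IsClifford (cnot c t h) := by
  refine isClifford_of_mul fun a b => ⟨cnotMap c t a, b + Pi.single c (b t), 1, ?_⟩
  have hd : ∀ x : Qubits n, (b + Pi.single c (b t)) ⬝ᵥ x = b ⬝ᵥ cnotMap c t x := fun x => by
    simp [cnotMap, add_dotProduct, dotProduct_add]
  rw [pauli_eq_monomial, pauli_eq_monomial, cnot_eq_monomial, monomial_mul, monomial_mul, one_smul]
  congr 1
  · funext u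
    simp only [Function.comp_apply, cnotMap_add, cnotMap_cnotMap h]
  · funext u
    simp only [hd, cnotMap_add, cnotMap_cnotMap h, one_mul, mul_one]

end Gates

/-! ### Strong oblivious transfer -/

section StrongObliviousTransfer

variable {n : ℕ}

/-- The strong oblivious transfer Clifford on the qubits `p` and `q` of an `n`-qubit register,
with `r₃ = 0`. -/
noncomputable def sotUnitaryOn (p q : Fin n) (h : p ≠ q) (x₀ x₁ r₀ r₁ r₂ : ZMod 2) :
    Matrix.unitaryGroup (Qubits n) ℂ :=
  pauli (Pi.single p r₂ + Pi.single q x₀) 0 *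
    (if x₀ = x₁ then 1 else cnot p q h * cnot q p h.symm) *
    pauli 0 (Pi.single p r₀ + Pi.single q r₁)

theorem isClifford_sotUnitaryOn {p q : Fin n} (h : p ≠ q) (x₀ x₁ r₀ r₁ r₂ : ZMod 2) :
    IsClifford (sotUnitaryOn p q h x₀ x₁ r₀ r₁ r₂) := by
  refine ((isClifford_pauli _ _).mul ?_).mul (isClifford_pauli _ _)
  split_ifs
  · exact isClifford_one
  · exact (isClifford_cnot h).mul (isClifford_cnot h.symm)

theorem sotUnitary_eq (x₀ x₁ r₀ r₁ r₂ : ZMod 2) :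
    sotUnitary x₀ x₁ r₀ r₁ r₂ 0 = sotUnitaryOn 0 1 (by decide) x₀ x₁ r₀ r₁ r₂ := by
  have e : ∀ s t : ZMod 2, (![s, t] : Qubits 2) = Pi.single 0 s + Pi.single 1 t := fun s t => by
    funext j
    fin_cases j <;> simp
  rw [sotUnitary, sotUnitaryOn, e, e, e]
  simp

/-- The basis state that strong oblivious transfer maps to `w`, if the sum of its bits at `p` and
`q` is `s` and the bit transferred for this `s` is `y`. Transfer adds `y` to the bit at `q`, so that
this bit is recovered as `w q + y`. -/
def sotPreimage (p q : Fin n) (s y : ZMod 2) (w : Qubits n) : Qubits n :=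
  Function.update (Function.update w q (w q + y)) p (s + (w q + y))

theorem sotPreimage_apply_fst (p q : Fin n) (s y : ZMod 2) (w : Qubits n) :
    sotPreimage p q s y w p = s + (w q + y) := by
  simp [sotPreimage]

theorem sotPreimage_apply_snd {p q : Fin n} (h : p ≠ q) (s y : ZMod 2) (w : Qubits n) :
    sotPreimage p q s y w q = w q + y := by
  simp [sotPreimage, h.symm]

/-- The sum of the two input bits of strong oblivious transfer, as a function of the two output bits
for `r₂ = 0`. -/
def sotIndex (x₀ x₁ u v : ZMod 2) : ZMod 2 := if x₀ = x₁ then u + v + x₀ else u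

/-- The basis state that the strong oblivious transfer Clifford maps to `w` up to a phase. -/
def sotPermutation (p q : Fin n) (x₀ x₁ r₂ : ZMod 2) (w : Qubits n) : Qubits n :=
  sotPreimage p q (r₂ + sotIndex x₀ x₁ (w p) (w q))
    (choose x₀ x₁ (r₂ + sotIndex x₀ x₁ (w p) (w q))) w

theorem add_eq_sotPermutation {p q : Fin n} (h : p ≠ q) (x r : ZMod 2) (w : Qubits n) :
    w + (Pi.single p r + Pi.single q x) = sotPermutation p q x x r w := by
  funext j
  rw [sotPermutation]
  by_cases hp : j = p
  · subst hp
    rw [sotPreimage_apply_fst, sotIndex, if_pos rfl, choose, ite_self]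
    simp only [Pi.add_apply, Pi.single_eq_same, Pi.single_eq_of_ne h]
    generalize w j = a
    generalize w q = b
    revert a b x r
    decide
  · by_cases hq : j = q
    · subst hq
      rw [sotPreimage_apply_snd h, choose, ite_self]
      simp [hp]
    · simp [sotPreimage, hp, hq]

theorem cnotMap_cnotMap_add_eq_sotPermutation {p q : Fin n} (h : p ≠ q) {x₀ x₁ : ZMod 2}
    (hx : x₀ ≠ x₁) (r : ZMod 2) (w : Qubits n) :
    cnotMap q p (cnotMap p q (w + (Pi.single p r + Pi.single q x₀))) =
      sotPermutation p q x₀ x₁ r w := by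
  funext j
  rw [sotPermutation, sotIndex, if_neg hx]
  by_cases hp : j = p
  · subst hp
    rw [sotPreimage_apply_fst]
    simp only [cnotMap, Pi.add_apply, Pi.single_eq_same, Pi.single_eq_of_ne h,
      Pi.single_eq_of_ne h.symm]
    generalize w j = a
    generalize w q = b
    revert a b x₀ x₁ r
    decide
  · by_cases hq : j = q
    · subst hq
      rw [sotPreimage_apply_snd h]
      simp only [cnotMap, Pi.add_apply, Pi.single_eq_same, Pi.single_eq_of_ne h,
        Pi.single_eq_of_ne h.symm]
      generalize w j = a
      generalize w p = b
      revert a b x₀ x₁ r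
      decide
    · simp [sotPreimage, cnotMap, hp, hq]

theorem sotUnitaryOn_eq_monomial {p q : Fin n} (h : p ≠ q) (x₀ x₁ r₀ r₁ r₂ : ZMod 2) :
    (sotUnitaryOn p q h x₀ x₁ r₀ r₁ r₂ : Matrix (Qubits n) (Qubits n) ℂ) =
      monomial (sotPermutation p q x₀ x₁ r₂) fun w =>
        sign (r₀ * sotPermutation p q x₀ x₁ r₂ w p) *
          sign (r₁ * sotPermutation p q x₀ x₁ r₂ w q) := by
  by_cases hx : x₀ = x₁
  · subst hx
    have e : (sotUnitaryOn p q h x₀ x₀ r₀ r₁ r₂ : Matrix (Qubits n) (Qubits n) ℂ) =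
        (pauli (Pi.single p r₂ + Pi.single q x₀) 0).1 *
          (pauli 0 (Pi.single p r₀ + Pi.single q r₁)).1 := by
      rw [sotUnitaryOn, if_pos rfl, mul_one]
      rfl
    rw [e, pauli_eq_monomial, pauli_eq_monomial, monomial_mul]
    congr 1
    · funext w
      simp only [Function.comp_apply, add_zero, add_eq_sotPermutation h]
    · funext w
      simp only [add_zero, add_eq_sotPermutation h, zero_dotProduct, sign_zero, one_mul,
        add_dotProduct, single_dotProduct, sign_add]
  · have e : (sotUnitaryOn p q h x₀ x₁ r₀ r₁ r₂ : Matrix (Qubits n) (Qubits n) ℂ) =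
        (pauli (Pi.single p r₂ + Pi.single q x₀) 0).1 * ((cnot p q h).1 * (cnot q p h.symm).1) *
          (pauli 0 (Pi.single p r₀ + Pi.single q r₁)).1 := by
      rw [sotUnitaryOn, if_neg hx]
      rfl
    rw [e, pauli_eq_monomial, pauli_eq_monomial, cnot_eq_monomial, cnot_eq_monomial, monomial_mul,
      monomial_mul, monomial_mul]
    congr 1
    · funext w
      simp only [Function.comp_apply, add_zero, cnotMap_cnotMap_add_eq_sotPermutation h hx]
    · funext w
      simp only [Function.comp_apply, add_zero, cnotMap_cnotMap_add_eq_sotPermutation h hx,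
        zero_dotProduct, sign_zero, one_mul, add_dotProduct, single_dotProduct, sign_add]

/-- The unnormalised state that remains of the input `ψ` of strong oblivious transfer, averaged over
`r₀`, `r₁` and `r₂`, if the sum of the input bits is `s` and the bit transferred for this `s` is
`y`. -/
noncomputable def sotBranch (p q : Fin n) {R : Type*} (ψ : Qubits n × R → ℂ) (s y : ZMod 2) :
    Matrix (Qubits n × R) (Qubits n × R) ℂ :=
  Matrix.of fun w w' => if w.1 p = w'.1 p ∧ w.1 q = w'.1 q then
    ψ (sotPreimage p q s y w.1, w.2) * star (ψ (sotPreimage p q s y w'.1, w'.2)) else 0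

theorem posSemidef_sotBranch (p q : Fin n) {R : Type*} [Fintype R] (ψ : Qubits n × R → ℂ)
    (s y : ZMod 2) : (sotBranch p q ψ s y).PosSemidef := by
  have e : sotBranch p q ψ s y = ∑ c : ZMod 2 × ZMod 2, proj fun w : Qubits n × R =>
      if (w.1 p, w.1 q) = c then ψ (sotPreimage p q s y w.1, w.2) else 0 := by
    ext w w'
    simp only [Matrix.sum_apply, proj, vecMulVec_apply, Pi.star_apply, ite_mul, zero_mul,
      Finset.sum_ite_eq, Finset.mem_univ, if_true, sotBranch, of_apply, Prod.mk.injEq]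
    by_cases hw : w.1 p = w'.1 p ∧ w.1 q = w'.1 q
    · simp [hw]
    · rw [if_neg hw, if_neg fun h => hw ⟨h.1.symm, h.2.symm⟩, star_zero, mul_zero]
  rw [e]
  exact posSemidef_sum _ fun c _ => posSemidef_vecMulVec_self_star _

theorem sotPermutation_agree_iff {p q : Fin n} (h : p ≠ q) (x₀ x₁ r : ZMod 2) (w w' : Qubits n) :
    (sotPermutation p q x₀ x₁ r w p = sotPermutation p q x₀ x₁ r w' p ∧
      sotPermutation p q x₀ x₁ r w q = sotPermutation p q x₀ x₁ r w' q) ↔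
      (w p = w' p ∧ w q = w' q) := by
  simp only [sotPermutation, sotPreimage_apply_fst, sotPreimage_apply_snd h, sotIndex, choose]
  generalize w p = a
  generalize w q = b
  generalize w' p = c
  generalize w' q = d
  revert x₀ x₁ r a b c d
  decide

theorem sum_sign_mul_sign (s t : ZMod 2) :
    ∑ r : ZMod 2, sign (r * s) * sign (r * t) = if s = t then 2 else 0 := by
  rw [sum_bits]
  rcases bit_cases s with rfl | rfl <;> rcases bit_cases t with rfl | rfl <;> norm_num

/-- The sum over `r₀` and `r₁` removes the coherences between different values of the input bits, and
the sum over `r₂` amounts to the sum over the two values of the sum of the input bits. -/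
theorem sum_sotClifford_applyRef_proj {p q : Fin n} (h : p ≠ q) {R : Type*} (ψ : Qubits n × R → ℂ)
    (x₀ x₁ : ZMod 2) :
    ∑ r : ZMod 2 × ZMod 2 × ZMod 2,
        (unitaryChannel (sotUnitaryOn p q h x₀ x₁ r.1 r.2.1 r.2.2)).applyRef (proj ψ) =
      (4 : ℂ) • sotBranch p q ψ 0 x₀ + (4 : ℂ) • sotBranch p q ψ 1 x₁ := by
  ext w w'
  simp only [Matrix.sum_apply, Channel.applyRef, ampliate, of_apply,
    unitaryChannel_toLin_apply (sotUnitaryOn_eq_monomial h _ _ _ _ _), Fintype.sum_prod_type]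
  have inner : ∀ r₂ : ZMod 2, ∑ r₀ : ZMod 2, ∑ r₁ : ZMod 2,
      (sign (r₀ * sotPermutation p q x₀ x₁ r₂ w.1 p) *
          sign (r₁ * sotPermutation p q x₀ x₁ r₂ w.1 q)) *
        proj ψ (sotPermutation p q x₀ x₁ r₂ w.1, w.2) (sotPermutation p q x₀ x₁ r₂ w'.1, w'.2) *
        star (sign (r₀ * sotPermutation p q x₀ x₁ r₂ w'.1 p) *
          sign (r₁ * sotPermutation p q x₀ x₁ r₂ w'.1 q)) =
      4 * sotBranch p q ψ (r₂ + sotIndex x₀ x₁ (w.1 p) (w.1 q))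
        (choose x₀ x₁ (r₂ + sotIndex x₀ x₁ (w.1 p) (w.1 q))) w w' := by
    intro r₂
    have e1 := sum_sign_mul_sign (sotPermutation p q x₀ x₁ r₂ w.1 p)
      (sotPermutation p q x₀ x₁ r₂ w'.1 p)
    have e2 := sum_sign_mul_sign (sotPermutation p q x₀ x₁ r₂ w.1 q)
      (sotPermutation p q x₀ x₁ r₂ w'.1 q)
    have hag := sotPermutation_agree_iff h x₀ x₁ r₂ w.1 w'.1
    trans (∑ r₀ : ZMod 2, sign (r₀ * sotPermutation p q x₀ x₁ r₂ w.1 p) *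
        sign (r₀ * sotPermutation p q x₀ x₁ r₂ w'.1 p)) *
      (∑ r₁ : ZMod 2, sign (r₁ * sotPermutation p q x₀ x₁ r₂ w.1 q) *
        sign (r₁ * sotPermutation p q x₀ x₁ r₂ w'.1 q)) *
      proj ψ (sotPermutation p q x₀ x₁ r₂ w.1, w.2) (sotPermutation p q x₀ x₁ r₂ w'.1, w'.2)
    · rw [Finset.sum_mul_sum, Finset.sum_mul]
      refine Finset.sum_congr rfl fun r₀ _ => ?_
      rw [Finset.sum_mul]
      refine Finset.sum_congr rfl fun r₁ _ => ?_
      rw [star_mul', star_sign, star_sign]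
      ring
    · rw [e1, e2]
      by_cases hw : w.1 p = w'.1 p ∧ w.1 q = w'.1 q
      · obtain ⟨g1, g2⟩ := hag.2 hw
        rw [if_pos g1, if_pos g2, sotBranch, of_apply, if_pos hw, proj, vecMulVec_apply,
          Pi.star_apply, sotPermutation, sotPermutation, ← hw.1, ← hw.2]
        norm_num
      · have hne : ¬ (_ ∧ _) := fun g => hw (hag.1 g)
        rw [sotBranch, of_apply, if_neg hw, mul_zero]
        rw [not_and_or] at hne
        rcases hne with g | g
        · rw [if_neg g, zero_mul, zero_mul]
        · rw [if_neg g, mul_zero, zero_mul]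
  have swap : ∀ f : ZMod 2 → ZMod 2 → ZMod 2 → ℂ, ∑ r₀, ∑ r₁, ∑ r₂, f r₀ r₁ r₂ =
      ∑ r₂, ∑ r₀, ∑ r₁, f r₀ r₁ r₂ := fun f => by
    simp only [sum_bits]
    ring
  rw [swap, Finset.sum_congr rfl fun r₂ _ => inner r₂]
  -- for a fixed output, `r₂` determines the sum of the input bits and vice versa
  rw [sum_bits]
  rcases bit_cases (sotIndex x₀ x₁ (w.1 p) (w.1 q)) with e | e <;> rw [e]
  · simp [choose]
  · simp [choose, show (1 + 1 : ZMod 2) = 0 from rfl, add_comm]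

theorem sotChannel_applyRef_proj {R : Type*} (ψ : Qubits 2 × R → ℂ) (x₀ x₁ : ZMod 2) :
    (sotChannel x₀ x₁).applyRef (proj ψ) =
      (1 / 2 : ℂ) • sotBranch 0 1 ψ 0 x₀ + (1 / 2 : ℂ) • sotBranch 0 1 ψ 1 x₁ := by
  ext w w'
  have vec : ∀ (u : Qubits 2) (s t : ZMod 2), ![s, t] = u ↔ s = u 0 ∧ t = u 1 := fun u s t => by
    constructor
    · rintro rfl
      exact ⟨rfl, rfl⟩
    · rintro ⟨rfl, rfl⟩
      funext j
      fin_cases j <;> rfl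
  have pre : ∀ (u : Qubits 2) (s y : ZMod 2), sotPreimage 0 1 s y u = ![s + (u 1 + y), u 1 + y] :=
    fun u s y => by
      funext j
      fin_cases j <;> simp [sotPreimage]
  simp only [Channel.applyRef, ampliate, of_apply, sotChannel, LinearMap.coe_mk, AddHom.coe_mk,
    Matrix.sum_apply, Matrix.smul_apply, Matrix.add_apply, single_apply, vec, sotBranch, pre,
    proj, vecMulVec_apply, Pi.star_apply, smul_eq_mul]
  by_cases hw : w.1 0 = w'.1 0 ∧ w.1 1 = w'.1 1
  · have ho : ∀ b : ZMod 2, (∑ o : ZMod 2, if (o = w.1 0 ∧ b = w.1 1) ∧ o = w'.1 0 ∧ b = w'.1 1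
        then (1 : ℂ) else 0) = if b = w.1 1 then 1 else 0 := fun b => by
      rw [← hw.1, ← hw.2]
      simp [ite_and]
    simp only [ho, if_pos hw]
    rw [← hw.2]
    generalize w.1 1 = b
    simp only [sum_bits]
    rcases bit_cases x₀ with rfl | rfl <;> rcases bit_cases x₁ with rfl | rfl <;>
      rcases bit_cases b with rfl | rfl <;>
      simp [choose, show (1 + 1 : ZMod 2) = 0 from rfl, mul_comm, add_comm]
  · have ho : ∀ b : ZMod 2, (∑ o : ZMod 2, if (o = w.1 0 ∧ b = w.1 1) ∧ o = w'.1 0 ∧ b = w'.1 1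
        then (1 : ℂ) else 0) = 0 := fun b => Finset.sum_eq_zero fun o _ => if_neg fun h =>
      hw ⟨h.1.1.symm.trans h.2.1, h.1.2.symm.trans h.2.2⟩
    simp [ho, if_neg hw]

theorem sotClifford_apply_single {p q : Fin n} (h : p ≠ q) (x₀ x₁ r₀ r₁ r₂ c : ZMod 2)
    {z : Qubits n} (hz : z q ≠ choose x₀ x₁ c) :
    (unitaryChannel (sotUnitaryOn p q h x₀ x₁ r₀ r₁ r₂)).toLin
      (Matrix.single (Pi.single p c) (Pi.single p c) 1) z z = 0 := by
  rw [unitaryChannel_toLin_apply (sotUnitaryOn_eq_monomial h _ _ _ _ _), single_apply, if_neg]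
  · simp
  · rintro ⟨e, -⟩
    have ep := congrFun e p
    have eq := congrFun e q
    rw [Pi.single_eq_same, sotPermutation, sotPreimage_apply_fst] at ep
    rw [Pi.single_eq_of_ne h.symm, sotPermutation, sotPreimage_apply_snd h] at eq
    rw [← eq, add_zero] at ep
    rw [← ep] at eq
    exact hz (CharTwo.add_eq_zero.1 eq.symm)

theorem sotChannel_apply_single (x₀ x₁ c : ZMod 2) {z : Qubits 2} (hz : z 1 ≠ choose x₀ x₁ c) :
    (sotChannel x₀ x₁).toLin (Matrix.single (Pi.single 0 c) (Pi.single 0 c) 1) z z = 0 := by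
  simp only [sotChannel, LinearMap.coe_mk, AddHom.coe_mk, Matrix.sum_apply, Matrix.smul_apply]
  refine Finset.sum_eq_zero fun i _ => Finset.sum_eq_zero fun i' _ => ?_
  by_cases hi : i = c ∧ i' = 0
  · obtain ⟨rfl, rfl⟩ := hi
    rw [Finset.sum_eq_zero, smul_zero, smul_zero]
    intro o _
    rw [single_apply, if_neg]
    rintro ⟨rfl, -⟩
    exact hz (by simp)
  · rw [single_apply, if_neg, zero_smul]
    rintro ⟨e, -⟩
    have e0 := congrFun e 0
    have e1 := congrFun e 1
    simp at e0 e1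
    exact hi ⟨e0.symm, e1.symm⟩

theorem Scheme.half_le_of_sotClifford {Ahat Ohat : Type*} [Fintype Ahat] [DecidableEq Ahat]
    [Fintype Ohat] [DecidableEq Ohat] {Q : Scheme (Qubits n) (Qubits n) Ahat Ohat} {ε εd εc : ℝ}
    {p q : Fin n} (h : p ≠ q) (hmem : ∀ x₀ x₁ r₀ r₁ r₂ : ZMod 2,
      unitaryChannel (sotUnitaryOn p q h x₀ x₁ r₀ r₁ r₂) ∈ Q.channels)
    (hcorr : Q.IsCorrect ε) (hpriv : Q.IsDataPrivate εd) (hcirc : Q.IsCircuitPrivate εc) :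
    1 / 2 ≤ εc + εd + 4 * √ε := by
  refine Scheme.half_le_of_obliviousTransfer hcorr hpriv hcirc
    (T := ZMod 2 × ZMod 2 × ZMod 2) (fun x₀ x₁ r => ⟨_, hmem x₀ x₁ r.1 r.2.1 r.2.2⟩)
    (a₀ := Pi.single p 0) (a₁ := Pi.single p 1) (d := fun z => z q)
    (fun x₀ x₁ r z hz => sotClifford_apply_single h _ _ _ _ _ _ (by simpa [choose] using hz))
    (fun x₀ x₁ r z hz => sotClifford_apply_single h _ _ _ _ _ _ (by simpa [choose] using hz))
    fun m ψ => ⟨fun s y => (4 : ℂ) • sotBranch p q ψ s y, fun s y => ?_,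
      sum_sotClifford_applyRef_proj h ψ⟩
  exact (posSemidef_sotBranch p q ψ s y).smul (by rw [Complex.nonneg_iff]; norm_num)

theorem Scheme.half_le_of_sotChannel {Ahat Ohat : Type*} [Fintype Ahat] [DecidableEq Ahat]
    [Fintype Ohat] [DecidableEq Ohat] {Q : Scheme (Qubits 2) (Qubits 2) Ahat Ohat} {ε εd εc : ℝ}
    (hmem : ∀ x₀ x₁ : ZMod 2, sotChannel x₀ x₁ ∈ Q.channels)
    (hcorr : Q.IsCorrect ε) (hpriv : Q.IsDataPrivate εd) (hcirc : Q.IsCircuitPrivate εc) :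
    1 / 2 ≤ εc + εd + 4 * √ε := by
  refine Scheme.half_le_of_obliviousTransfer hcorr hpriv hcirc
    (T := Unit) (fun x₀ x₁ _ => ⟨_, hmem x₀ x₁⟩)
    (a₀ := Pi.single 0 0) (a₁ := Pi.single 0 1) (d := fun z => z 1)
    (fun x₀ x₁ _ z hz => sotChannel_apply_single _ _ _ (by simpa [choose] using hz))
    (fun x₀ x₁ _ z hz => sotChannel_apply_single _ _ _ (by simpa [choose] using hz))
    fun m ψ => ⟨fun s y => (1 / 2 : ℂ) • sotBranch 0 1 ψ s y,
      fun s y => posSemidef_half_smul (posSemidef_sotBranch 0 1 ψ s y), fun x₀ x₁ => ?_⟩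
  rw [Finset.univ_unique, Finset.sum_singleton]
  exact sotChannel_applyRef_proj ψ x₀ x₁

end StrongObliviousTransfer

end QHE

theorem mainTheorem1 {Ahat Ohat : Type*} [Fintype Ahat] [DecidableEq Ahat]
    [Fintype Ohat] [DecidableEq Ohat] (ε εd εc : ℝ) :
    (∀ Q : QHE.Scheme (QHE.Qubits 2) (QHE.Qubits 2) Ahat Ohat,
      (∀ x₀ x₁ : ZMod 2, QHE.sotChannel x₀ x₁ ∈ Q.channels) →
      Q.IsCorrect ε → Q.IsDataPrivate εd → Q.IsCircuitPrivate εc →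
      εc + εd + 4 * Real.sqrt ε ≥ 1 / 2) ∧
    (∀ Q : QHE.Scheme (QHE.Qubits 2) (QHE.Qubits 2) Ahat Ohat,
      (∀ x₀ x₁ r₀ r₁ r₂ r₃ : ZMod 2, QHE.sotClifford x₀ x₁ r₀ r₁ r₂ r₃ ∈ Q.channels) →
      Q.IsCorrect ε → Q.IsDataPrivate εd → Q.IsCircuitPrivate εc →
      εc + εd + 4 * Real.sqrt ε ≥ 1 / 2) ∧
    (∀ (n : ℕ) (_ : 2 ≤ n) (Q : QHE.Scheme (QHE.Qubits n) (QHE.Qubits n) Ahat Ohat),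
      (∀ U : Matrix.unitaryGroup (QHE.Qubits n) ℂ, QHE.IsClifford U →
        QHE.unitaryChannel U ∈ Q.channels) →
      Q.IsCorrect ε → Q.IsDataPrivate εd → Q.IsCircuitPrivate εc →
      εc + εd + 4 * Real.sqrt ε ≥ 1 / 2) := by
  refine ⟨fun Q hmem hcorr hpriv hcirc => ?_, fun Q hmem hcorr hpriv hcirc => ?_,
    fun n hn Q hmem hcorr hpriv hcirc => ?_⟩
  · exact Q.half_le_of_sotChannel hmem hcorr hpriv hcirc
  · refine Q.half_le_of_sotClifford (p := 0) (q := 1) (by decide) (fun x₀ x₁ r₀ r₁ r₂ => ?_)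
      hcorr hpriv hcirc
    -- the phase `Z ^ r₃` is immaterial after the dephasing of the inputs
    have h := hmem x₀ x₁ r₀ r₁ r₂ 0
    rwa [QHE.sotClifford, QHE.sotUnitary_eq] at h
  · have h : (⟨0, by omega⟩ : Fin n) ≠ ⟨1, by omega⟩ := by simp
    exact Q.half_le_of_sotClifford h
      (fun x₀ x₁ r₀ r₁ r₂ => hmem _ (QHE.isClifford_sotUnitaryOn h x₀ x₁ r₀ r₁ r₂))
      hcorr hpriv hcirc
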